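/- Let $\phi^{T,s},\phi^{T,c},\phi^{F,s},\phi^{F,c},\phi^{N,s},\phi^{N,c}:\mathbb R\to[0,\infty)$ be integrable and vanish on $(-\infty,0)$, let $\mu\ge 0$ and $I\ge 0$. For $?\in\{T,F,N\}$ let $\Phi^?$ be the $2\times2$ matrix with diagonal entries $\phi^{?,s}$ and off-diagonal entries $\phi^{?,c}$, and put $\hat f_z=\int e^{-izt}f_t\,dt$ and $\Delta\hat\phi^?_z=\hat\phi^{?,s}_z-\hat\phi^{?,c}_z$. Assume the stability condition: all eigenvalues of $$\begin{pmatrix}\hat\Phi^T_0&\hat\Phi^F_0\\ I\,\mathbb I&\hat\Phi^N_0\end{pmatrix}$$ have modulus smaller than $1$. For a nonnegative integrable function $\phi^I$ supported in $[0,\infty)$, with $\Phi^I=\phi^I\,\mathbb I$, consider on the whole time line the four-dimensional Hawkes process $P=(T^-,T^+,N^-,N^+)$ (anonymous sell and buy trades, downward and upward price jumps) in the presence of one labeled agent who sends a single buying market order at time $0$ ($dA^+=\delta_0$, $dA^-=0$), where the labeled order has the same impact on the price as an anonymous one and no influence on the anonymous trades ($\Theta^I=\Phi^I$, $\Theta^T=0$).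 That is, the conditional intensity of $P$ is $$\lambda_t=\begin{pmatrix}\mu\\\mu\\0\\0\end{pmatrix}+\int\begin{pmatrix}\Phi^T&\Phi^F\\\Phi^I&\Phi^N\end{pmatrix}(t-s)\,dP_s+\int\begin{pmatrix}0\\\Phi^I\end{pmatrix}(t-s)\,dA_s,\qquad A=\begin{pmatrix}A^-\\A^+\end{pmatrix};$$ the mean numbers of jumps in bounded intervals are finite, and before time $0$ they are bounded uniformly over intervals of length one (as in the stationary regime). Its market impact profile is $MI_t=E(N^+_t-N^-_t)$, jumps being counted from time $0$. The impulsive impact kernel $\phi^I=I\delta$ is understood as the limit of nonnegative functions $\phi^{I,(n)}$ with $\int\phi^{I,(n)}=I$ and support in $[0,w_n]$, $w_n\to0$. Then for every $z\in\mathbb C$ with $\operatorname{Im}z\le 0$ one has $(1-\Delta\hat\phi^T_z)(1-\Delta\hat\phi^N_z)-I\,\Delta\hat\phi^F_z\neq0$, and there is an integrable function $\Delta\xi$, vanishing on $(-\infty,0)$ and unique almost everywhere, with $$\widehat{\Delta\xi}_z=1-\frac{1-\Delta\hat\phi^T_z}{(1-\Delta\hat\phi^T_z)(1-\Delta\hat\phi^N_z)-I\,\Delta\hat\phi^F_z}\qquad(\operatorname{Im}z\le0).$$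 With an impulsive impact kernel, the market impact profile of the single buying order is $$MI_t=I\Bigl(1-\int_0^t\Delta\xi_u\,du\Bigr)\qquad(t>0),$$ that is, for every sequence of kernels $\phi^{I,(n)}$ as above and every choice of corresponding processes, the market impact profiles $MI^{(n)}_t$ converge to the right-hand side for every $t>0$. -/

import Mathlib

open MeasureTheory Filter Topology
open scoped ENNReal NNReal

namespace MarketImpact

/-- Labels of the four counting processes: `inl 0, inl 1` stand for the trades `T⁻, T⁺`, and
`inr 0, inr 1` for the downward and upward price jumps `N⁻, N⁺`. -/
abbrev Comp : Type := Fin 2 ⊕ Fin 2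

/-- A scalar Hawkes kernel: a nonnegative, causal, integrable function. -/
structure IsKernel (f : ℝ → ℝ) : Prop where
  measurable : Measurable f
  integrable : Integrable f
  nonneg : ∀ t, 0 ≤ f t
  causal : ∀ t, t < 0 → f t = 0

/-- The Laplace transform `∫ e^{-izt} f(t) dt`. -/
noncomputable def laplace (f : ℝ → ℝ) (z : ℂ) : ℂ :=
  ∫ t : ℝ, Complex.exp (-(Complex.I * z * (t : ℂ))) * (f t : ℂ)

/-- A bisymmetric `2 × 2` kernel, given by its `self` and `cross` terms. -/
structure SymKernel where
  self : ℝ → ℝ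
  cross : ℝ → ℝ

namespace SymKernel

/-- Both the self and the cross term are scalar Hawkes kernels. -/
def IsKernel (K : SymKernel) : Prop :=
  MarketImpact.IsKernel K.self ∧ MarketImpact.IsKernel K.cross

/-- The `2 × 2` matrix of the kernel at time `t`. -/
def mat (K : SymKernel) (t : ℝ) : Matrix (Fin 2) (Fin 2) ℝ :=
  !![K.self t, K.cross t; K.cross t, K.self t]

/-- The entrywise Laplace transform. -/
noncomputable def hat (K : SymKernel) (z : ℂ) : Matrix (Fin 2) (Fin 2) ℂ :=
  !![laplace K.self z, laplace K.cross z; laplace K.cross z, laplace K.self z]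

/-- The Laplace transform of the kernel's imbalance, self term minus cross term. -/
noncomputable def imb (K : SymKernel) (z : ℂ) : ℂ :=
  laplace K.self z - laplace K.cross z

end SymKernel

/-- The `4 × 4` Hawkes kernel `Φ = (Φᵀ Φᶠ; Φᴵ Φᴺ)`. -/
def hawkesKernel (KT KF KI KN : SymKernel) (t : ℝ) : Matrix Comp Comp ℝ :=
  Matrix.fromBlocks (KT.mat t) (KF.mat t) (KI.mat t) (KN.mat t)

/-- The kernel `Θ = (Θᵀ; Θᴵ)` of the labeled agent, for `Θᵀ = 0` and `Θᴵ = Φᴵ`. -/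
def agentKernel (KI : SymKernel) (t : ℝ) : Matrix Comp (Fin 2) ℝ :=
  Matrix.fromRows 0 (KI.mat t)

/-- The order flow `(dA⁻, dA⁺) = (0, δ₀)`: a single buying market order at time `0`. -/
noncomputable def singleBuy : Fin 2 → Measure ℝ :=
  ![0, Measure.dirac 0]

/-- The exogenous intensity `M = (μ, μ, 0, 0)`. -/
def exogenous (rate : ℝ≥0) : Comp → ℝ≥0∞ :=
  Sum.elim (fun _ => (rate : ℝ≥0∞)) (fun _ => 0)

/-- The counting measure `dP` of a set of jump times. -/
noncomputable def counting (S : Set ℝ) : Measure ℝ :=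
  Measure.count.restrict S

/-- The intensity `λ_t = M + ∫ Φ(t-s) dP_s + ∫ Θ(t-s) dA_s`, component `i`, for the sets `S j` of
jump times of the components of `P`. -/
noncomputable def intensity (rate : ℝ≥0) (Φ : ℝ → Matrix Comp Comp ℝ)
    (Θ : ℝ → Matrix Comp (Fin 2) ℝ) (A : Fin 2 → Measure ℝ) (S : Comp → Set ℝ)
    (i : Comp) (t : ℝ) : ℝ≥0∞ :=
  exogenous rate i
    + ∑ j, ∫⁻ s, ENNReal.ofReal (Φ (t - s) i j) ∂(counting (S j))
    + ∑ k, ∫⁻ s, ENNReal.ofReal (Θ (t - s) i k) ∂(A k)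

/-- `S` (the random sets of jump times) is a four-dimensional Hawkes process on the whole line
with a labeled agent, with respect to the filtration `ℱ`: a locally finite adapted point process
without common jumps and with locally finite mean, whose conditional intensity is `intensity`.
The mean number of jumps per unit of time is bounded in the past, before the agent acts; this is
so when the process is in its stationary regime there. -/
structure IsLabeledHawkes {Ω : Type*} {mΩ : MeasurableSpace Ω} (ℙ : Measure Ω)
    (ℱ : Filtration ℝ mΩ) (rate : ℝ≥0) (Φ : ℝ → Matrix Comp Comp ℝ)
    (Θ : ℝ → Matrix Comp (Fin 2) ℝ) (A : Fin 2 → Measure ℝ)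
    (S : Comp → Ω → Set ℝ) : Prop where
  locallyFinite : ∀ i ω a b, (S i ω ∩ Set.Icc a b).Finite
  noCommonJumps : ∀ᵐ ω ∂ℙ, ∀ i j, i ≠ j → Disjoint (S i ω) (S j ω)
  adapted : ∀ i s t, s ≤ t → Measurable[ℱ t] (fun ω => counting (S i ω) (Set.Ioc s t))
  mean_lt_top : ∀ i s t, ∫⁻ ω, counting (S i ω) (Set.Ioc s t) ∂ℙ < ∞
  mean_past_bounded : ∃ C : ℝ≥0, ∀ i, ∀ t ≤ (0 : ℝ),
    ∫⁻ ω, counting (S i ω) (Set.Ioc (t - 1) t) ∂ℙ ≤ C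
  conditional_intensity : ∀ i s t, s ≤ t → ∀ B : Set Ω, MeasurableSet[ℱ s] B →
    ∫⁻ ω in B, counting (S i ω) (Set.Ioc s t) ∂ℙ
      = ∫⁻ ω in B, (∫⁻ u in Set.Ioc s t, intensity rate Φ Θ A (fun j => S j ω) i u) ∂ℙ

/-- The market impact profile `MI_t = E(N⁺_t - N⁻_t)`, jumps being counted from time `0`. -/
noncomputable def marketImpact {Ω : Type*} {mΩ : MeasurableSpace Ω} (ℙ : Measure Ω)
    (S : Comp → Ω → Set ℝ) (t : ℝ) : ℝ :=
  ∫ ω, ((counting (S (Sum.inr 1) ω) (Set.Ioc 0 t)).toReal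
    - (counting (S (Sum.inr 0) ω) (Set.Ioc 0 t)).toReal) ∂ℙ

/-- The stability condition for the impulsive impact kernel of mass `c`: all the eigenvalues of
`Φ̂₀`, in which the impact block is `c` times the identity, have modulus smaller than `1`. -/
def ImpulsiveStable (KT KF KN : SymKernel) (c : ℝ) : Prop :=
  ∀ x ∈ spectrum ℂ (Matrix.fromBlocks (KT.hat 0) (KF.hat 0)
    ((c : ℂ) • (1 : Matrix (Fin 2) (Fin 2) ℂ)) (KN.hat 0)), ‖x‖ < 1

/-- The impact kernels `KI n` are positive functions of mass `c` on the diagonal, supported in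
`[0, w n]` with `w n → 0`, and have no cross term; they tend to `c δ` times the identity. -/
def IsImpulsive (KI : ℕ → SymKernel) (c : ℝ) : Prop :=
  (∀ n, (KI n).IsKernel) ∧ (∀ n, (KI n).cross = 0) ∧ (∀ n, ∫ t, (KI n).self t = c) ∧
    ∃ w : ℕ → ℝ, Tendsto w atTop (𝓝 0) ∧
      ∀ n, Function.support (KI n).self ⊆ Set.Icc 0 (w n)

/-- The denominator `(1 - Δφ̂ᵀ)(1 - Δφ̂ᴺ) - c Δφ̂ᶠ`. -/
noncomputable def xiDenom (KT KF KN : SymKernel) (c : ℝ) (z : ℂ) : ℂ :=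
  (1 - KT.imb z) * (1 - KN.imb z) - (c : ℂ) * KF.imb z

/-- The prescribed Laplace transform of `Δξ`. -/
noncomputable def xiHat (KT KF KN : SymKernel) (c : ℝ) (z : ℂ) : ℂ :=
  1 - (1 - KT.imb z) / xiDenom KT KF KN c z

end MarketImpact

/-! Taking expectations in the conditional intensity shows that the mean jump measures have
densities solving a linear convolution system. Subtract the minus components from the plus
components: the rate `μ` cancels, and bisymmetry closes the system on the imbalance `x` of the
trades and `y` of the price jumps, x = ΔφT * x + ΔφF * y, y = φI * x + ΔφN * y + φI, while `MI_t` is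
the integral of `y` over `(0, t]`. As `φI → c δ`, one expects `x ≈ c x'` and `y ≈ φI + c θ`, where
x' = ΔφT * x' + ΔφF * θ + ΔφF, θ = c x' + ΔφN * θ + ΔφN. Eliminating `x̂'` from the transformed
limit system identifies `ξ = -θ`, and integrating `φI + c θ` gives `c (1 - ∫ ξ)`.

Let `a`, `b`, `e` be the masses (self plus cross) of the kernels T, F, N. Stability, tested on the
vectors `(p, p, q, q)`, yields `a < 1`, `e < 1` and `c b < (1 - a)(1 - e)`
(`ImpulsiveStable.inequalities`). Since |self - cross| ≤ self + cross, this controls the imbalances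
as well: it solves the limit system in L¹ (`exists_integrable_solution`), keeps the denominator away
from zero (`xiDenom_ne_zero`), makes the solution causal and bounds the error for a given `φI`
(`windowSup_error_bound`).

The densities live on the whole line and are only known to have bounded integrals over past unit
windows, so L¹ norms are not available for `x` and `y`. The error is measured by `windowSup`, for
which causal convolution is bounded by the L¹ norm of the kernel. The sources of the error are terms
`g * φI - c g`, which vanish in L¹ as `φI` concentrates (`tendsto_lintegral_conv_sub`). -/

namespace MarketImpact

/-! ### Convolution on the line -/

/-- The convolution `∫ k(u-s) f(s) ds`. -/
noncomputable def conv (k f : ℝ → ℝ) (u : ℝ) : ℝ := ∫ s, k (u - s) * f s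

lemma conv_eq_convolution (k f : ℝ → ℝ) :
    conv k f = convolution k f (ContinuousLinearMap.mul ℝ ℝ) volume := by
  ext u
  exact convolution_mul_swap.symm

lemma integrable_conv {k f : ℝ → ℝ} (hk : Integrable k) (hf : Integrable f) :
    Integrable (conv k f) := by
  rw [conv_eq_convolution]
  exact hk.integrable_convolution _ hf

lemma ae_integrable_conv_integrand {k f : ℝ → ℝ} (hk : Integrable k) (hf : Integrable f) :
    ∀ᵐ u : ℝ, Integrable fun s => k (u - s) * f s := by
  filter_upwards [hk.ae_convolution_exists (ContinuousLinearMap.mul ℝ ℝ) hf] with u hu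
  exact hu.integrable_swap

lemma conv_congr {k f g : ℝ → ℝ} (h : f =ᵐ[volume] g) : conv k f = conv k g := by
  ext u
  refine integral_congr_ae ?_
  filter_upwards [h] with s hs
  rw [hs]

/-- The convolution of two `[0, ∞]`-valued functions. -/
noncomputable def lconv (k f : ℝ → ℝ≥0∞) (u : ℝ) : ℝ≥0∞ := ∫⁻ s, k (u - s) * f s

lemma measurable_lconv {k f : ℝ → ℝ≥0∞} (hk : Measurable k) (hf : Measurable f) :
    Measurable (lconv k f) := by
  unfold lconv
  have : Measurable fun p : ℝ × ℝ => k (p.1 - p.2) * f p.2 := by fun_prop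
  exact this.lintegral_prod_right'

/-- Tonelli after the substitution `s ↦ u - s`. A window of the convolution is an average of windows
of `f`, moved to the past when `s ≥ 0`. -/
lemma setLIntegral_lconv {k f : ℝ → ℝ≥0∞} (hk : Measurable k) (hf : Measurable f) (a b : ℝ) :
    ∫⁻ u in Set.Ioc a b, lconv k f u
      = ∫⁻ s, k s * ∫⁻ u in Set.Ioc (a - s) (b - s), f u := by
  have h1 : ∀ u, lconv k f u = ∫⁻ s, k s * f (u - s) := by
    intro u
    unfold lconv
    rw [← lintegral_sub_left_eq_self (fun s => k s * f (u - s)) u]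
    simp
  simp_rw [h1]
  have hm : Measurable fun p : ℝ × ℝ => k p.2 * f (p.1 - p.2) := by fun_prop
  rw [lintegral_lintegral_swap hm.aemeasurable]
  refine lintegral_congr fun s => ?_
  rw [lintegral_const_mul _ (by fun_prop)]
  congr 1
  rw [← lintegral_indicator measurableSet_Ioc, ← lintegral_indicator measurableSet_Ioc,
    ← lintegral_sub_right_eq_self ((Set.Ioc (a - s) (b - s)).indicator f) s]
  refine lintegral_congr fun u => ?_
  simp only [Set.indicator, Set.mem_Ioc, sub_lt_sub_iff_right, sub_le_sub_iff_right]

lemma lintegral_lconv {k f : ℝ → ℝ≥0∞} (hk : Measurable k) (hf : Measurable f) :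
    ∫⁻ u, lconv k f u = (∫⁻ s, k s) * ∫⁻ u, f u := by
  unfold lconv
  have hm : Measurable fun p : ℝ × ℝ => k (p.1 - p.2) * f p.2 := by fun_prop
  rw [lintegral_lintegral_swap hm.aemeasurable]
  have : ∀ s, ∫⁻ u, k (u - s) * f s = (∫⁻ s, k s) * f s := by
    intro s
    rw [lintegral_mul_const _ (by fun_prop), lintegral_sub_right_eq_self]
  simp_rw [this]
  rw [lintegral_const_mul _ hf]

lemma enorm_conv_le (k f : ℝ → ℝ) (u : ℝ) :
    ‖conv k f u‖ₑ ≤ lconv (fun s => ‖k s‖ₑ) (fun s => ‖f s‖ₑ) u := by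
  refine (enorm_integral_le_lintegral_enorm _).trans (le_of_eq ?_)
  simp [lconv, enorm_mul]

lemma lconv_congr_left {k k' f : ℝ → ℝ≥0∞} (h : k =ᵐ[volume] k') (u : ℝ) :
    lconv k f u = lconv k' f u := by
  refine lintegral_congr_ae ?_
  filter_upwards [(quasiMeasurePreserving_sub_left volume u).ae_eq_comp h] with s hs
  simp only [Function.comp] at hs
  rw [hs]

lemma lconv_congr_right {k f f' : ℝ → ℝ≥0∞} (h : f =ᵐ[volume] f') (u : ℝ) :
    lconv k f u = lconv k f' u := by
  refine lintegral_congr_ae ?_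
  filter_upwards [h] with s hs
  rw [hs]

lemma lintegral_enorm_conv_le {k f : ℝ → ℝ} (hk : Integrable k) (hf : Integrable f) :
    ∫⁻ u, ‖conv k f u‖ₑ ≤ (∫⁻ s, ‖k s‖ₑ) * ∫⁻ s, ‖f s‖ₑ := by
  have hk' := hk.1.enorm
  have hf' := hf.1.enorm
  calc ∫⁻ u, ‖conv k f u‖ₑ ≤ ∫⁻ u, lconv (fun s => ‖k s‖ₑ) (fun s => ‖f s‖ₑ) u :=
        lintegral_mono fun u => enorm_conv_le k f u
    -- Integrable functions are only a.e. measurable, whereas `lintegral_lconv` needs Borel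
    -- representatives.
    _ = ∫⁻ u, lconv (hk'.mk _) (hf'.mk _) u := by
        refine lintegral_congr fun u => ?_
        rw [lconv_congr_left hk'.ae_eq_mk, lconv_congr_right hf'.ae_eq_mk]
    _ = _ := by
        rw [lintegral_lconv hk'.measurable_mk hf'.measurable_mk,
          lintegral_congr_ae hk'.ae_eq_mk, lintegral_congr_ae hf'.ae_eq_mk]

/-! ### The supremum of the integrals over past windows of length one -/

/-- The supremum of the integrals of `f` over the intervals `(t-1, t]`, `t ≤ τ`. -/
noncomputable def windowSup (f : ℝ → ℝ≥0∞) (τ : ℝ) : ℝ≥0∞ :=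
  ⨆ t ∈ Set.Iic τ, ∫⁻ u in Set.Ioc (t - 1) t, f u

lemma le_windowSup (f : ℝ → ℝ≥0∞) {t τ : ℝ} (h : t ≤ τ) :
    ∫⁻ u in Set.Ioc (t - 1) t, f u ≤ windowSup f τ :=
  le_iSup₂_of_le (f := fun t (_ : t ∈ Set.Iic τ) => ∫⁻ u in Set.Ioc (t - 1) t, f u) t h le_rfl

lemma windowSup_le_iff {f : ℝ → ℝ≥0∞} {τ : ℝ} {C : ℝ≥0∞} :
    windowSup f τ ≤ C ↔ ∀ t ≤ τ, ∫⁻ u in Set.Ioc (t - 1) t, f u ≤ C := by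
  simp [windowSup]

lemma windowSup_mono_ae {f g : ℝ → ℝ≥0∞} (τ : ℝ) (h : ∀ᵐ u : ℝ, f u ≤ g u) :
    windowSup f τ ≤ windowSup g τ :=
  windowSup_le_iff.2 fun _ ht =>
    (lintegral_mono_ae (ae_restrict_of_ae h)).trans (le_windowSup g ht)

lemma windowSup_le_lintegral (f : ℝ → ℝ≥0∞) (τ : ℝ) : windowSup f τ ≤ ∫⁻ u, f u :=
  windowSup_le_iff.2 fun _ _ => setLIntegral_le_lintegral _ _

lemma windowSup_add_le {f g : ℝ → ℝ≥0∞} (hf : AEMeasurable f) (τ : ℝ) :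
    windowSup (fun u => f u + g u) τ ≤ windowSup f τ + windowSup g τ := by
  refine windowSup_le_iff.2 fun t ht => ?_
  rw [lintegral_add_left' hf.restrict]
  exact add_le_add (le_windowSup f ht) (le_windowSup g ht)

/-- A causal kernel only sees windows ending no later than `τ`, so the supremum over the past is
stable under convolution, at the cost of the mass of the kernel. -/
lemma windowSup_lconv_le {k f : ℝ → ℝ≥0∞} (hk : Measurable k) (hf : Measurable f)
    (hcausal : ∀ t, t < 0 → k t = 0) (τ : ℝ) :
    windowSup (lconv k f) τ ≤ (∫⁻ s, k s) * windowSup f τ := by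
  refine windowSup_le_iff.2 fun t ht => ?_
  rw [setLIntegral_lconv hk hf, ← lintegral_mul_const _ hk]
  refine lintegral_mono fun s => ?_
  rcases lt_or_ge s 0 with hs | hs
  · simp [hcausal s hs]
  · dsimp only
    gcongr
    have := le_windowSup f (t := t - s) (τ := τ) (by linarith)
    rwa [show t - s - 1 = t - 1 - s by ring] at this

lemma setLIntegral_le_mul_windowSup (f : ℝ → ℝ≥0∞) (t : ℝ) (n : ℕ) :
    ∫⁻ u in Set.Ioc (t - n) t, f u ≤ n * windowSup f t := by
  induction n with
  | zero => simp
  | succ n ih =>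
    have : Set.Ioc (t - (n + 1 : ℕ)) t
        = Set.Ioc (t - n - 1) (t - n) ∪ Set.Ioc (t - n) t := by
      rw [Set.Ioc_union_Ioc_eq_Ioc (by linarith) (by linarith [n.cast_nonneg (α := ℝ)])]
      push_cast; ring_nf
    rw [this]
    refine (lintegral_union_le _ _ _).trans ?_
    rw [add_comm]
    push_cast
    rw [add_mul, one_mul]
    exact add_le_add ih (le_windowSup f (by linarith [n.cast_nonneg (α := ℝ)]))

lemma ae_eq_zero_of_windowSup_eq_zero {f : ℝ → ℝ≥0∞} (hf : AEMeasurable f) {τ : ℝ}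
    (h : windowSup f τ = 0) : ∀ᵐ u : ℝ, u ≤ τ → f u = 0 := by
  have h1 : ∀ n : ℕ, ∀ᵐ u : ℝ, u ∈ Set.Ioc (τ - n) τ → f u = 0 := by
    intro n
    rw [← ae_restrict_iff' measurableSet_Ioc]
    have := setLIntegral_le_mul_windowSup f τ n
    rw [h, mul_zero, nonpos_iff_eq_zero, lintegral_eq_zero_iff' hf.restrict] at this
    exact this
  filter_upwards [ae_all_iff.2 h1] with u hu huτ
  obtain ⟨n, hn⟩ := exists_nat_gt (τ - u)
  exact hu n ⟨by linarith, huτ⟩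

/-! ### A linear system of convolution inequalities -/

/-- Add `c` times the first inequality to `1 - a` times the second; `X` drops out. Finiteness of `X`
and `Y` is what permits moving terms to the left. -/
lemma ennreal_system_bound {a b c e : ℝ} (hb : 0 ≤ b) (hc : 0 ≤ c)
    (ha0 : 0 ≤ a) (he0 : 0 ≤ e) (ha : a < 1) {X Y r₁ r₂ : ℝ≥0∞}
    (hX : X ≠ ∞) (hY : Y ≠ ∞) (h₁ : r₁ ≠ ∞) (h₂ : r₂ ≠ ∞)
    (hx : X ≤ ENNReal.ofReal a * X + ENNReal.ofReal b * Y + r₁)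
    (hy : Y ≤ ENNReal.ofReal c * X + ENNReal.ofReal e * Y + r₂) :
    ((1 - a) * (1 - e) - c * b) * Y.toReal ≤ c * r₁.toReal + (1 - a) * r₂.toReal := by
  lift X to ℝ≥0 using hX
  lift Y to ℝ≥0 using hY
  lift r₁ to ℝ≥0 using h₁
  lift r₂ to ℝ≥0 using h₂
  lift a to ℝ≥0 using ha0
  lift b to ℝ≥0 using hb
  lift c to ℝ≥0 using hc
  lift e to ℝ≥0 using he0
  simp only [ENNReal.ofReal_coe_nnreal, ENNReal.coe_toReal] at *
  have hx' : (X : ℝ) ≤ a * X + b * Y + r₁ := by exact_mod_cast hx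
  have hy' : (Y : ℝ) ≤ c * X + e * Y + r₂ := by exact_mod_cast hy
  have h3 := mul_le_mul_of_nonneg_left hx' c.coe_nonneg
  have h4 := mul_le_mul_of_nonneg_left hy' (sub_nonneg.2 ha.le)
  linarith

lemma windowSup_const_mul_le {f : ℝ → ℝ≥0∞} {r : ℝ≥0∞} (hr : r ≠ ∞) (τ : ℝ) :
    windowSup (fun u => r * f u) τ ≤ r * windowSup f τ := by
  refine windowSup_le_iff.2 fun t ht => ?_
  rw [lintegral_const_mul' _ _ hr]
  gcongr
  exact le_windowSup f ht

lemma windowSup_le_of_le_lconv_add {k f g R : ℝ → ℝ≥0∞} {κ : ℝ≥0∞} (hk : Measurable k)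
    (hf : Measurable f) (hcausal : ∀ t, t < 0 → k t = 0) (hκ : ∫⁻ s, k s ≤ κ)
    (h : ∀ᵐ u : ℝ, R u ≤ lconv k f u + g u) (τ : ℝ) :
    windowSup R τ ≤ κ * windowSup f τ + windowSup g τ :=
  calc windowSup R τ ≤ _ := windowSup_mono_ae τ h
    _ ≤ _ := windowSup_add_le (measurable_lconv hk hf).aemeasurable τ
    _ ≤ _ := by
      gcongr
      exact (windowSup_lconv_le hk hf hcausal τ).trans (by gcongr)

/-- Turns a pointwise convolution inequality into a numerical one, of the form that
`ennreal_system_bound` takes. -/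
lemma windowSup_le_of_le_lconv_add_lconv_add {k k' f f' g R : ℝ → ℝ≥0∞} {κ κ' : ℝ≥0∞}
    (hk : Measurable k) (hf : Measurable f) (hk' : Measurable k') (hf' : Measurable f')
    (hcausal : ∀ t, t < 0 → k t = 0) (hcausal' : ∀ t, t < 0 → k' t = 0)
    (hκ : ∫⁻ s, k s ≤ κ) (hκ' : ∫⁻ s, k' s ≤ κ')
    (h : ∀ᵐ u : ℝ, R u ≤ lconv k f u + lconv k' f' u + g u) (τ : ℝ) :
    windowSup R τ ≤ κ * windowSup f τ + κ' * windowSup f' τ + windowSup g τ := by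
  refine (windowSup_le_of_le_lconv_add (g := fun u => lconv k' f' u + g u) hk hf hcausal hκ
    (h.mono fun u hu => hu.trans (add_assoc _ _ _).le) τ).trans ?_
  rw [add_assoc]
  gcongr
  exact windowSup_le_of_le_lconv_add hk' hf' hcausal' hκ' (.of_forall fun _ => le_rfl) τ

/-! ### Convolution operators on `L¹` -/

lemma conv_add_ae {k f g : ℝ → ℝ} (hk : Integrable k) (hf : Integrable f) (hg : Integrable g) :
    conv k (f + g) =ᵐ[volume] conv k f + conv k g := by
  filter_upwards [ae_integrable_conv_integrand hk hf, ae_integrable_conv_integrand hk hg]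
    with u h1 h2
  simp only [conv, Pi.add_apply, mul_add]
  exact integral_add h1 h2

lemma conv_const_mul (k f : ℝ → ℝ) (r : ℝ) : conv k (r • f) = r • conv k f := by
  ext u
  simp only [conv, Pi.smul_apply, smul_eq_mul, ← integral_const_mul]
  exact integral_congr_ae (.of_forall fun s => by ring)

lemma conv_comm (k f : ℝ → ℝ) : conv k f = conv f k := by
  ext u
  unfold conv
  rw [← integral_sub_left_eq_self _ volume u]
  exact integral_congr_ae (.of_forall fun s => by simp [mul_comm])

/-- Convolution with an integrable function, as an operator on `L¹`. -/
noncomputable def convOp {k : ℝ → ℝ} (hk : Integrable k) :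
    Lp ℝ 1 (volume : Measure ℝ) →L[ℝ] Lp ℝ 1 (volume : Measure ℝ) :=
  LinearMap.mkContinuous
    { toFun := fun g => (integrable_conv hk (L1.integrable_coeFn g)).toL1 _
      map_add' := by
        intro f g
        rw [← Integrable.toL1_add, Integrable.toL1_eq_toL1_iff]
        rw [conv_congr (Lp.coeFn_add f g)]
        exact conv_add_ae hk (L1.integrable_coeFn f) (L1.integrable_coeFn g)
      map_smul' := by
        intro r f
        rw [RingHom.id_apply, ← Integrable.toL1_smul, Integrable.toL1_eq_toL1_iff]
        rw [conv_congr (Lp.coeFn_smul r f)]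
        exact .of_forall fun u => congrFun (conv_const_mul k f r) u }
    (∫ t, ‖k t‖) (by
      intro g
      have h := lintegral_enorm_conv_le hk (L1.integrable_coeFn g)
      have h1 := (integrable_conv hk (L1.integrable_coeFn g))
      simp only [LinearMap.coe_mk, AddHom.coe_mk]
      rw [L1.norm_eq_integral_norm g, integral_norm_eq_lintegral_enorm hk.1,
        integral_norm_eq_lintegral_enorm (L1.integrable_coeFn g).1, ← ENNReal.toReal_mul,
        ← toReal_enorm, Integrable.enorm_toL1]
      exact ENNReal.toReal_mono
        (ENNReal.mul_ne_top hk.2.ne (L1.integrable_coeFn g).2.ne) h)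

lemma norm_convOp_le {k : ℝ → ℝ} (hk : Integrable k) : ‖convOp hk‖ ≤ ∫ t, ‖k t‖ :=
  LinearMap.mkContinuous_norm_le _ (integral_nonneg fun _ => norm_nonneg _) _

lemma coeFn_convOp {k : ℝ → ℝ} (hk : Integrable k) (g : Lp ℝ 1 (volume : Measure ℝ)) :
    convOp hk g =ᵐ[volume] conv k g :=
  Integrable.coeFn_toL1 (integrable_conv hk (L1.integrable_coeFn g))

/-- A contraction perturbation of the identity has a right inverse with the geometric bound. -/
lemma exists_rightInverse_one_sub {E : Type*} [NormedAddCommGroup E] [NormedSpace ℝ E]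
    [CompleteSpace E] (A : E →L[ℝ] E) {a : ℝ} (hA : ‖A‖ ≤ a) (ha : a < 1) :
    ∃ R : E →L[ℝ] E, (∀ w, R w = A (R w) + w) ∧ ‖R‖ ≤ (1 - a)⁻¹ := by
  have h := hA.trans_lt ha
  refine ⟨((Units.oneSub A h)⁻¹ : (E →L[ℝ] E)ˣ), ?_, ?_⟩
  · intro w
    have h1 := congrArg (fun B : E →L[ℝ] E => B w) (Units.oneSub A h).mul_inv
    simp only [Units.val_oneSub, _root_.mul_apply_eq_comp, _root_.sub_apply,
      _root_.one_apply_eq_self] at h1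
    rw [sub_eq_iff_eq_add] at h1
    rw [add_comm]; exact h1
  -- The bound comes from the equation `z = A z + w`, which gives `‖z‖ ≤ a ‖z‖ + ‖w‖`.
  · refine ContinuousLinearMap.opNorm_le_bound _ (inv_nonneg.2 (by linarith)) fun w => ?_
    have h1 := congrArg (fun B : E →L[ℝ] E => B w) (Units.oneSub A h).mul_inv
    simp only [Units.val_oneSub, _root_.mul_apply_eq_comp, _root_.sub_apply,
      _root_.one_apply_eq_self] at h1
    set z := ((Units.oneSub A h)⁻¹ : (E →L[ℝ] E)ˣ).val w
    have h2 : ‖z‖ ≤ ‖A z‖ + ‖w‖ := by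
      rw [sub_eq_iff_eq_add] at h1
      calc ‖z‖ = ‖w + A z‖ := by rw [← h1]
        _ ≤ _ := (norm_add_le _ _).trans (add_comm _ _).le
    have h3 : ‖A z‖ ≤ a * ‖z‖ := (A.le_opNorm z).trans (by gcongr)
    rw [inv_mul_eq_div, le_div_iff₀ (by linarith)]
    linarith

/-- Solve the first equation for `x` with `R = (1 - T)⁻¹`. What remains is a fixed-point equation
for `θ` with operator `c R F + N`, of norm at most `c b / (1 - a) + e < 1`. -/
lemma exists_integrable_solution {a b c e : ℝ} (hc : 0 ≤ c) (ha : a < 1)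
    (hstab : c * b < (1 - a) * (1 - e)) {T F N : ℝ → ℝ}
    (hT : Integrable T) (hF : Integrable F) (hN : Integrable N)
    (iT : ∫ t, ‖T t‖ ≤ a) (iF : ∫ t, ‖F t‖ ≤ b) (iN : ∫ t, ‖N t‖ ≤ e) :
    ∃ x θ : ℝ → ℝ, Integrable x ∧ Integrable θ ∧
      x =ᵐ[volume] conv T x + conv F θ + F ∧ θ =ᵐ[volume] c • x + conv N θ + N := by
  obtain ⟨R, hR, hRn⟩ := exists_rightInverse_one_sub (convOp hT) ((norm_convOp_le hT).trans iT) ha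
  have hA : ‖c • (R * convOp hF) + convOp hN‖ ≤ c * ((1 - a)⁻¹ * b) + e := by
    refine (norm_add_le _ _).trans (add_le_add ?_ ((norm_convOp_le hN).trans iN))
    rw [norm_smul, Real.norm_of_nonneg hc]
    refine mul_le_mul_of_nonneg_left ((norm_mul_le _ _).trans ?_) hc
    exact mul_le_mul hRn ((norm_convOp_le hF).trans iF) (norm_nonneg _)
      (inv_nonneg.2 (by linarith))
  have hlt : c * ((1 - a)⁻¹ * b) + e < 1 := by
    have : c * ((1 - a)⁻¹ * b) = c * b / (1 - a) := by
      rw [div_eq_mul_inv]; ring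
    rw [this, ← lt_sub_iff_add_lt, div_lt_iff₀ (by linarith)]
    linarith
  obtain ⟨Q, hQ, -⟩ := exists_rightInverse_one_sub _ hA hlt
  set θ := Q (c • R (hF.toL1 F) + hN.toL1 N)
  set x := R (convOp hF θ + hF.toL1 F)
  have hx : x = convOp hT x + (convOp hF θ + hF.toL1 F) := hR _
  have hθ : θ = c • x + convOp hN θ + hN.toL1 N := by
    have h1 : θ = _ := hQ (c • R (hF.toL1 F) + hN.toL1 N)
    have h2 : x = R (convOp hF θ) + R (hF.toL1 F) := map_add _ _ _
    rw [h2]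
    simp only [_root_.add_apply, _root_.smul_apply,
      _root_.mul_apply_eq_comp] at h1
    refine h1.trans ?_
    rw [smul_add]
    abel
  refine ⟨x, θ, L1.integrable_coeFn x, L1.integrable_coeFn θ, ?_, ?_⟩
  · have h1 : (x : ℝ → ℝ) =ᵐ[volume] ↑↑(convOp hT x + (convOp hF θ + hF.toL1 F)) := by rw [← hx]
    filter_upwards [h1, Lp.coeFn_add (convOp hT x) (convOp hF θ + hF.toL1 F),
      Lp.coeFn_add (convOp hF θ) (hF.toL1 F), coeFn_convOp hT x, coeFn_convOp hF θ,
      hF.coeFn_toL1] with u h1 h2 h3 h4 h5 h6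
    rw [h1, h2, Pi.add_apply, h3, Pi.add_apply, h4, h5, h6]
    simp [add_assoc]
  · have h1 : (θ : ℝ → ℝ) =ᵐ[volume] ↑↑(c • x + convOp hN θ + hN.toL1 N) := by rw [← hθ]
    filter_upwards [h1, Lp.coeFn_add (c • x + convOp hN θ) (hN.toL1 N),
      Lp.coeFn_add (c • x) (convOp hN θ), Lp.coeFn_smul c x, coeFn_convOp hN θ,
      hN.coeFn_toL1] with u h1 h2 h3 h4 h5 h6
    rw [h1, h2, Pi.add_apply, h3, Pi.add_apply, h4, h5, h6]
    simp

/-! ### Approximate identities -/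

/-- Translations act continuously on L¹. -/
lemma tendsto_lintegral_enorm_translate_sub {f : ℝ → ℝ} (hf : Integrable f) :
    Tendsto (fun s => ∫⁻ u, ‖f (u - s) - f u‖ₑ) (𝓝 0) (𝓝 0) := by
  have hm : MemLp f 1 volume := memLp_one_iff_integrable.2 hf
  have : Fact ((1 : ℝ≥0∞) ≠ ∞) := ⟨ENNReal.one_ne_top⟩
  have hcont : Continuous fun s : ℝ => (DomAddAct.mk (-s)) +ᵥ hm.toLp f :=
    (DomAddAct.continuous_mk.comp continuous_neg).vadd continuous_const
  have h0 := tendsto_iff_edist_tendsto_0.1 (hcont.tendsto 0)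
  refine h0.congr fun s => ?_
  rw [DomAddAct.mk_vadd_toLp, DomAddAct.mk_vadd_toLp, Lp.edist_toLp_toLp,
    eLpNorm_one_eq_lintegral_enorm]
  refine lintegral_congr fun u => ?_
  simp [neg_add_eq_sub]

/-- As `φ n` has mass `c`, the difference is the `φ n`-average of `g(u - s) - g(u)`. By Tonelli its
L¹ norm is at most the `φ n`-average of the L¹ modulus of continuity `ω`, and only `s ∈ [0, w n]`
counts. -/
lemma tendsto_lintegral_conv_sub {g : ℝ → ℝ} (hg : Integrable g) {c : ℝ}
    {φ : ℕ → ℝ → ℝ} (hφ : ∀ n, IsKernel (φ n)) (hint : ∀ n, ∫ t, φ n t = c)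
    {w : ℕ → ℝ} (hw : Tendsto w atTop (𝓝 0))
    (hsupp : ∀ n, Function.support (φ n) ⊆ Set.Icc 0 (w n)) :
    Tendsto (fun n => ∫⁻ u, ‖conv g (φ n) u - c * g u‖ₑ) atTop (𝓝 0) := by
  set ω : ℝ → ℝ≥0∞ := fun s => ∫⁻ u, ‖g (u - s) - g u‖ₑ
  have hbound : ∀ n, ∫⁻ u, ‖conv g (φ n) u - c * g u‖ₑ ≤ ∫⁻ s, ENNReal.ofReal (φ n s) * ω s := by
    intro n
    have hm : AEMeasurable (fun p : ℝ × ℝ => ENNReal.ofReal (φ n p.2) * ‖g (p.1 - p.2) - g p.1‖ₑ)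
        (volume.prod volume) := by
      have h1 : AEStronglyMeasurable (fun p : ℝ × ℝ => g (p.1 - p.2)) (volume.prod volume) :=
        hg.1.comp_quasiMeasurePreserving (quasiMeasurePreserving_sub volume volume)
      have h2 : AEStronglyMeasurable (fun p : ℝ × ℝ => g p.1) (volume.prod volume) :=
        hg.1.comp_fst
      have h3 : Measurable fun p : ℝ × ℝ => ENNReal.ofReal (φ n p.2) :=
        ((hφ n).measurable.comp measurable_snd).ennreal_ofReal
      exact h3.aemeasurable.mul (h1.sub h2).enorm
    calc ∫⁻ u, ‖conv g (φ n) u - c * g u‖ₑ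
        ≤ ∫⁻ u, ∫⁻ s, ENNReal.ofReal (φ n s) * ‖g (u - s) - g u‖ₑ := by
          refine lintegral_mono_ae ?_
          filter_upwards [ae_integrable_conv_integrand hg (hφ n).integrable] with u hu
          have : conv g (φ n) u - c * g u = ∫ s, φ n s * (g (u - s) - g u) := by
            rw [← hint n, ← integral_mul_const, conv, ← integral_sub hu
              ((hφ n).integrable.mul_const _)]
            exact integral_congr_ae (.of_forall fun s => by ring)
          rw [this]
          refine (enorm_integral_le_lintegral_enorm _).trans (le_of_eq ?_)
          refine lintegral_congr fun s => ?_
          rw [enorm_mul, Real.enorm_of_nonneg ((hφ n).nonneg s)]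
      _ = ∫⁻ s, ∫⁻ u, ENNReal.ofReal (φ n s) * ‖g (u - s) - g u‖ₑ :=
          lintegral_lintegral_swap hm
      _ = _ := by
          refine lintegral_congr fun s => ?_
          rw [lintegral_const_mul' _ _ ENNReal.ofReal_ne_top]
  have hω := tendsto_lintegral_enorm_translate_sub hg
  rw [ENNReal.tendsto_atTop_zero]
  intro ε hε
  obtain ⟨δ, hδ, hδε⟩ : ∃ δ : ℝ≥0∞, 0 < δ ∧ ENNReal.ofReal c * δ ≤ ε := by
    rcases eq_or_ne ε ∞ with rfl | hε'
    · exact ⟨1, one_pos, le_top⟩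
    rcases eq_or_ne (ENNReal.ofReal c) 0 with h0 | h0
    · exact ⟨1, one_pos, by simp [h0]⟩
    · exact ⟨ε / ENNReal.ofReal c, ENNReal.div_pos hε.ne' ENNReal.ofReal_ne_top,
        ENNReal.mul_div_le⟩
  obtain ⟨r, hr, hball⟩ := Metric.eventually_nhds_iff.1 (hω.eventually_le_const hδ)
  obtain ⟨M, hM⟩ := eventually_atTop.1 (hw.eventually_lt_const hr)
  refine ⟨M, fun n hn => (hbound n).trans (le_trans ?_ hδε)⟩
  calc ∫⁻ s, ENNReal.ofReal (φ n s) * ω s ≤ ∫⁻ s, ENNReal.ofReal (φ n s) * δ := by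
        refine lintegral_mono fun s => ?_
        by_cases hs : φ n s = 0
        · simp [hs]
        · have := hsupp n hs
          dsimp only
          gcongr
          refine hball ?_
          rw [Real.dist_eq, sub_zero, abs_of_nonneg this.1]
          exact this.2.trans_lt (hM n hn)
    _ = ENNReal.ofReal c * δ := by
        rw [lintegral_mul_const _ (hφ n).measurable.ennreal_ofReal, ← hint n,
          ofReal_integral_eq_lintegral_ofReal (hφ n).integrable (.of_forall (hφ n).nonneg)]

/-! ### The Laplace transform -/

lemma norm_exp_laplace (z : ℂ) (t : ℝ) :
    ‖Complex.exp (-(Complex.I * z * (t : ℂ)))‖ = Real.exp (z.im * t) := by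
  rw [Complex.norm_exp]
  simp

lemma norm_laplace_integrand_le {f : ℝ → ℝ} (hc : ∀ t, t < 0 → f t = 0) {z : ℂ}
    (hz : z.im ≤ 0) (t : ℝ) :
    ‖Complex.exp (-(Complex.I * z * (t : ℂ))) * (f t : ℂ)‖ ≤ ‖f t‖ := by
  rw [norm_mul, norm_exp_laplace, Complex.norm_real]
  rcases lt_or_ge t 0 with ht | ht
  · simp [hc t ht]
  · refine mul_le_of_le_one_left (norm_nonneg _) (Real.exp_le_one_iff.2 ?_)
    exact mul_nonpos_of_nonpos_of_nonneg hz ht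

lemma integrable_laplace_integrand {f : ℝ → ℝ} (hf : Integrable f)
    (hc : ∀ t, t < 0 → f t = 0) {z : ℂ} (hz : z.im ≤ 0) :
    Integrable fun t : ℝ => Complex.exp (-(Complex.I * z * (t : ℂ))) * (f t : ℂ) := by
  refine hf.mono ?_ (.of_forall (norm_laplace_integrand_le hc hz))
  exact (Continuous.aestronglyMeasurable (by fun_prop)).mul
    (Complex.continuous_ofReal.comp_aestronglyMeasurable hf.1)

lemma norm_laplace_le {f : ℝ → ℝ} (hf : Integrable f)
    (hc : ∀ t, t < 0 → f t = 0) {z : ℂ} (hz : z.im ≤ 0) : ‖laplace f z‖ ≤ ∫ t, ‖f t‖ :=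
  norm_integral_le_of_norm_le hf.norm (.of_forall (norm_laplace_integrand_le hc hz))

lemma laplace_congr {f g : ℝ → ℝ} (h : f =ᵐ[volume] g) (z : ℂ) : laplace f z = laplace g z := by
  refine integral_congr_ae ?_
  filter_upwards [h] with t ht
  rw [ht]

lemma laplace_add {f g : ℝ → ℝ} (hf : Integrable f) (hg : Integrable g)
    (hfc : ∀ t, t < 0 → f t = 0) (hgc : ∀ t, t < 0 → g t = 0) {z : ℂ} (hz : z.im ≤ 0) :
    laplace (f + g) z = laplace f z + laplace g z := by
  unfold laplace
  rw [← integral_add (integrable_laplace_integrand hf hfc hz)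
    (integrable_laplace_integrand hg hgc hz)]
  exact integral_congr_ae (.of_forall fun t => by simp [mul_add])

lemma laplace_smul (c : ℝ) (f : ℝ → ℝ) (z : ℂ) : laplace (c • f) z = c * laplace f z := by
  unfold laplace
  rw [← integral_const_mul]
  exact integral_congr_ae (.of_forall fun t => by simp; ring)

lemma conv_causal {k f : ℝ → ℝ} (hk : ∀ t, t < 0 → k t = 0) (hf : ∀ t, t < 0 → f t = 0) :
    ∀ t, t < 0 → conv k f t = 0 := by
  intro t ht
  refine integral_eq_zero_of_ae (.of_forall fun s => ?_)
  rcases lt_or_ge s 0 with hs | hs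
  · simp [hf s hs]
  · simp [hk (t - s) (by linarith)]

/-- The exponential is multiplicative, so weighting by it commutes with convolution. -/
lemma laplace_conv {k f : ℝ → ℝ} (hk : Integrable k) (hf : Integrable f)
    (hkc : ∀ t, t < 0 → k t = 0) (hfc : ∀ t, t < 0 → f t = 0) {z : ℂ} (hz : z.im ≤ 0) :
    laplace (conv k f) z = laplace k z * laplace f z := by
  have h := integral_convolution (ContinuousLinearMap.mul ℝ ℂ)
    (integrable_laplace_integrand hk hkc hz) (integrable_laplace_integrand hf hfc hz)
  simp only [ContinuousLinearMap.mul_apply'] at h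
  rw [laplace, laplace, laplace, ← h]
  refine integral_congr_ae (.of_forall fun u => ?_)
  dsimp only
  rw [convolution_eq_swap, conv, ← integral_complex_ofReal, ← integral_const_mul]
  refine integral_congr_ae (.of_forall fun s => ?_)
  dsimp only
  have : Complex.exp (-(Complex.I * z * (u : ℂ)))
      = Complex.exp (-(Complex.I * z * ((u - s : ℝ) : ℂ))) * Complex.exp (-(Complex.I * z * (s : ℂ))) := by
    rw [← Complex.exp_add]; congr 1; push_cast; ring
  rw [this, ContinuousLinearMap.mul_apply']; push_cast; ring

/-- The finite measures with densities `f⁺` and `f⁻` have the same characteristic function, hence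
coincide; but `f⁺` and `f⁻` are never both positive. -/
lemma ae_eq_zero_of_laplace_eq_zero {f : ℝ → ℝ} (hf : Integrable f)
    (h : ∀ z : ℝ, laplace f z = 0) : f =ᵐ[volume] 0 := by
  have hfin : ∀ {g : ℝ → ℝ}, Integrable g →
      IsFiniteMeasure (volume.withDensity fun t => ENNReal.ofReal (g t)) := fun hg =>
    isFiniteMeasure_withDensity_ofReal hg.2
  have := hfin hf
  have := hfin hf.neg
  have hchar : ∀ {g : ℝ → ℝ}, Integrable g → ∀ t : ℝ,
      charFun (volume.withDensity fun t => ENNReal.ofReal (g t)) t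
        = ∫ x : ℝ, (max (g x) 0) • Complex.exp (t * x * Complex.I) := by
    intro g hg t
    rw [charFun_apply_real, integral_withDensity_eq_integral_toReal_smul₀
      hg.1.aemeasurable.ennreal_ofReal (.of_forall fun _ => ENNReal.ofReal_lt_top)]
    simp_rw [ENNReal.toReal_ofReal']
  have hint : ∀ {g : ℝ → ℝ}, Integrable g → ∀ t : ℝ,
      Integrable fun x : ℝ => (max (g x) 0) • Complex.exp (t * x * Complex.I) := by
    intro g hg t
    refine hg.pos_part.mono
      (hg.pos_part.1.smul (Continuous.aestronglyMeasurable (by fun_prop))) (.of_forall fun x => ?_)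
    rw [norm_smul, ← Complex.ofReal_mul, Complex.norm_exp_ofReal_mul_I, mul_one]
  have heq : (volume.withDensity fun t => ENNReal.ofReal (f t))
      = volume.withDensity fun t => ENNReal.ofReal ((-f) t) := by
    refine Measure.ext_of_charFun (funext fun t => ?_)
    rw [hchar hf, hchar hf.neg, ← sub_eq_zero, ← integral_sub (hint hf t) (hint hf.neg t),
      ← h (-t), laplace]
    refine integral_congr_ae (.of_forall fun x => ?_)
    have h1 : f x = max (f x) 0 - max ((-f) x) 0 := by
      rcases le_total (f x) 0 with h | h <;> simp [h]
    have h2 : -(Complex.I * ((-t : ℝ) : ℂ) * (x : ℂ)) = t * x * Complex.I := by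
      push_cast; ring
    dsimp only
    rw [h2]
    conv_rhs => rw [h1]
    simp only [Complex.real_smul]
    push_cast
    ring
  rw [withDensity_eq_iff hf.1.aemeasurable.ennreal_ofReal
    hf.neg.1.aemeasurable.ennreal_ofReal (hf.lintegral_lt_top.ne)] at heq
  filter_upwards [heq] with x hx
  change f x = 0
  rcases le_total (f x) 0 with h | h
  · rw [ENNReal.ofReal_of_nonpos h, eq_comm, ENNReal.ofReal_eq_zero] at hx
    simp only [Pi.neg_apply] at hx
    exact le_antisymm h (by linarith)
  · rw [Pi.neg_apply, ENNReal.ofReal_of_nonpos (by linarith : -f x ≤ 0),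
      ENNReal.ofReal_eq_zero] at hx
    exact le_antisymm hx h

lemma integrable_laplace_integrand_real {f : ℝ → ℝ} (hf : Integrable f) (z : ℝ) :
    Integrable fun t : ℝ => Complex.exp (-(Complex.I * (z : ℂ) * (t : ℂ))) * (f t : ℂ) := by
  refine hf.mono ((Continuous.aestronglyMeasurable (by fun_prop)).mul
    (Complex.continuous_ofReal.comp_aestronglyMeasurable hf.1)) (.of_forall fun t => ?_)
  rw [norm_mul, norm_exp_laplace]
  simp

/-- An integrable function is determined by its Fourier transform. -/
lemma ae_eq_of_laplace_eq {f g : ℝ → ℝ} (hf : Integrable f) (hg : Integrable g)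
    (h : ∀ z : ℝ, laplace f z = laplace g z) : f =ᵐ[volume] g := by
  have h0 : f - g =ᵐ[volume] 0 := by
    refine ae_eq_zero_of_laplace_eq_zero (hf.sub hg) fun z => ?_
    rw [← sub_eq_zero.2 (h z), laplace, laplace, laplace,
      ← integral_sub (integrable_laplace_integrand_real hf z)
        (integrable_laplace_integrand_real hg z)]
    exact integral_congr_ae (.of_forall fun t => by simp [mul_sub])
  filter_upwards [h0] with u hu
  exact sub_eq_zero.1 hu

/-! ### Mean measures of the jumps -/

section MeanMeasure

variable {Ω : Type*} {mΩ : MeasurableSpace Ω} {ℙ : Measure Ω} {ℱ : Filtration ℝ mΩ} {rate : ℝ≥0}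
  {Φ : ℝ → Matrix Comp Comp ℝ} {Θ : ℝ → Matrix Comp (Fin 2) ℝ} {A : Fin 2 → Measure ℝ}
  {S : Comp → Ω → Set ℝ}

lemma isLocallyFiniteMeasure_counting {D : Set ℝ} (hD : ∀ a b, (D ∩ Set.Icc a b).Finite) :
    IsLocallyFiniteMeasure (counting D) := by
  refine ⟨fun x => ⟨Set.Icc (x - 1) (x + 1), Icc_mem_nhds (by linarith) (by linarith), ?_⟩⟩
  rw [counting, Measure.restrict_apply measurableSet_Icc, Set.inter_comm]
  exact Measure.count_apply_lt_top.2 (hD _ _)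

/-- The intervals form a π-system, which settles the finite restrictions to `(-n, n]`; then let `n →
∞`. This allows the mean jump measure to be formed by `Measure.bind`. -/
lemma measurable_measure_real {α : Type*} [MeasurableSpace α] {κ : α → Measure ℝ}
    (hfin : ∀ ω, IsLocallyFiniteMeasure (κ ω))
    (h : ∀ s t, s ≤ t → Measurable fun ω => κ ω (Set.Ioc s t)) : Measurable κ := by
  have hIoc : ∀ s t, Measurable fun ω => κ ω (Set.Ioc s t) := by
    intro s t
    rcases le_total s t with hst | hst
    · exact h s t hst
    · simp [Set.Ioc_eq_empty_of_le hst]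
  have hr : ∀ n : ℕ, Measurable fun ω => (κ ω).restrict (Set.Ioc (-n : ℝ) n) := by
    intro n
    have : ∀ ω, IsFiniteMeasure ((κ ω).restrict (Set.Ioc (-n : ℝ) n)) := fun ω =>
      ⟨by rw [Measure.restrict_apply_univ]; exact measure_Ioc_lt_top⟩
    refine Measurable.measure_of_isPiSystem 
      (BorelSpace.measurable_eq.trans (borel_eq_generateFrom_Ioc ℝ)) (isPiSystem_Ioc id id) ?_ ?_
    · rintro _ ⟨a, b, -, rfl⟩
      simp only [Measure.restrict_apply measurableSet_Ioc, Set.Ioc_inter_Ioc]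
      exact hIoc _ _
    · simp only [Measure.restrict_apply_univ]
      exact hIoc _ _
  refine Measure.measurable_of_measurable_coe _ fun B hB => ?_
  have hB' : ∀ ω, κ ω B = ⨆ n : ℕ, (κ ω).restrict (Set.Ioc (-n : ℝ) n) B := by
    intro ω
    have h1 : B = ⋃ n : ℕ, B ∩ Set.Ioc (-n : ℝ) n := by
      rw [← Set.inter_iUnion]
      refine (Set.inter_eq_left.2 fun x _ => Set.mem_iUnion.2 ?_).symm
      obtain ⟨n, hn⟩ := exists_nat_gt |x|
      exact ⟨n, (abs_lt.1 hn).1, (abs_lt.1 hn).2.le⟩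
    have h2 : Monotone fun n : ℕ => B ∩ Set.Ioc (-n : ℝ) n := by
      intro n m hnm
      have : (n : ℝ) ≤ m := by exact_mod_cast hnm
      exact Set.inter_subset_inter_right _ (Set.Ioc_subset_Ioc (by linarith) this)
    conv_lhs => rw [h1, h2.measure_iUnion]
    simp only [Measure.restrict_apply hB]
  simp_rw [hB']
  exact Measurable.iSup fun n => (Measure.measurable_coe hB).comp (hr n)

/-- The mean intensity for the mean jump measures `ν`. -/
noncomputable def meanIntensity (rate : ℝ≥0) (Φ : ℝ → Matrix Comp Comp ℝ)
    (Θ : ℝ → Matrix Comp (Fin 2) ℝ) (A : Fin 2 → Measure ℝ) (ν : Comp → Measure ℝ)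
    (i : Comp) (t : ℝ) : ℝ≥0∞ :=
  exogenous rate i
    + ∑ j, ∫⁻ s, ENNReal.ofReal (Φ (t - s) i j) ∂(ν j)
    + ∑ k, ∫⁻ s, ENNReal.ofReal (Θ (t - s) i k) ∂(A k)

lemma measurable_lintegral_translate {f : ℝ → ℝ} (hf : Measurable f) (ν : Measure ℝ) [SFinite ν] :
    Measurable fun t => ∫⁻ s, ENNReal.ofReal (f (t - s)) ∂ν := by
  have : Measurable fun p : ℝ × ℝ => ENNReal.ofReal (f (p.1 - p.2)) := by fun_prop
  exact this.lintegral_prod_right'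

lemma setLIntegral_lintegral_translate {f : ℝ → ℝ} (hf : Measurable f) (ν : Measure ℝ) [SFinite ν]
    (B : Set ℝ) :
    ∫⁻ t in B, ∫⁻ s, ENNReal.ofReal (f (t - s)) ∂ν
      = ∫⁻ s, (∫⁻ t in B, ENNReal.ofReal (f (t - s))) ∂ν := by
  have : Measurable fun p : ℝ × ℝ => ENNReal.ofReal (f (p.1 - p.2)) := by fun_prop
  exact lintegral_lintegral_swap this.aemeasurable

lemma setLIntegral_meanIntensity (hΦ : ∀ i j, Measurable fun t => Φ t i j)
    (hΘ : ∀ i j, Measurable fun t => Θ t i j) [∀ k, SFinite (A k)] (ν : Comp → Measure ℝ)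
    [∀ j, SFinite (ν j)] (i : Comp) (B : Set ℝ) :
    ∫⁻ u in B, meanIntensity rate Φ Θ A ν i u
      = (∫⁻ _ in B, exogenous rate i)
        + ∑ j, ∫⁻ s, (∫⁻ u in B, ENNReal.ofReal (Φ (u - s) i j)) ∂(ν j)
        + ∫⁻ u in B, ∑ k, ∫⁻ s, ENNReal.ofReal (Θ (u - s) i k) ∂(A k) := by
  have h1 := fun j => measurable_lintegral_translate (hΦ i j) (ν j)
  have h2 := fun k => measurable_lintegral_translate (hΘ i k) (A k)
  unfold meanIntensity
  rw [lintegral_add_right _ (Finset.measurable_fun_sum _ fun k _ => h2 k),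
    lintegral_add_right _ (Finset.measurable_fun_sum _ fun k _ => h1 k),
    lintegral_finsetSum _ fun k _ => h1 k]
  simp_rw [setLIntegral_lintegral_translate (hΦ i _)]

/-- The intensity is affine in the jump measures, so its expectation is the same expression in the
mean measures `ν`. That expression is therefore the density of `ν`, and inserting it back gives a
closed system, valid at every `u`. -/
lemma IsLabeledHawkes.exists_mean_density [IsProbabilityMeasure ℙ]
    (h : IsLabeledHawkes ℙ ℱ rate Φ Θ A S)
    (hΦ : ∀ i j, Measurable fun t => Φ t i j)
    (hΘ : ∀ i j, Measurable fun t => Θ t i j) [∀ k, SFinite (A k)] :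
    ∃ m : Comp → ℝ → ℝ≥0∞, (∀ i, Measurable (m i)) ∧
      (∀ i s t, ∫⁻ ω, counting (S i ω) (Set.Ioc s t) ∂ℙ = ∫⁻ u in Set.Ioc s t, m i u) ∧
      ∀ i u, m i u = exogenous rate i
        + ∑ j, lconv (fun t => ENNReal.ofReal (Φ t i j)) (m j) u
        + ∑ k, ∫⁻ s, ENNReal.ofReal (Θ (u - s) i k) ∂(A k) := by
  have hlf : ∀ i ω, IsLocallyFiniteMeasure (counting (S i ω)) := fun i ω =>
    isLocallyFiniteMeasure_counting (h.locallyFinite i ω)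
  have hκ : ∀ i, Measurable fun ω => counting (S i ω) := fun i =>
    measurable_measure_real (hlf i) fun s t hst => (h.adapted i s t hst).mono (ℱ.le t) le_rfl
  set ν : Comp → Measure ℝ := fun i => ℙ.bind fun ω => counting (S i ω)
  have hνB : ∀ i B, MeasurableSet B → ν i B = ∫⁻ ω, counting (S i ω) B ∂ℙ := fun i B hB =>
    Measure.bind_apply hB (hκ i).aemeasurable
  have hνlf : ∀ i, IsLocallyFiniteMeasure (ν i) := by
    refine fun i => ⟨fun x => ⟨Set.Ioc (x - 1) (x + 1), Ioc_mem_nhds (by linarith) (by linarith), ?_⟩⟩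
    rw [hνB _ _ measurableSet_Ioc]
    exact h.mean_lt_top i _ _
  set m := meanIntensity rate Φ Θ A ν
  have hm : ∀ i, Measurable (m i) := fun i =>
    (measurable_const.add (Finset.measurable_fun_sum _ fun j _ =>
      measurable_lintegral_translate (hΦ i j) (ν j))).add
      (Finset.measurable_fun_sum _ fun k _ => measurable_lintegral_translate (hΘ i k) (A k))
  have hIoc : ∀ i s t, s ≤ t → ν i (Set.Ioc s t) = ∫⁻ u in Set.Ioc s t, m i u := by
    intro i s t hst
    have hci := h.conditional_intensity i s t hst Set.univ MeasurableSet.univ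
    simp only [Measure.restrict_univ] at hci
    have hG : ∀ j, Measurable fun x => ∫⁻ u in Set.Ioc s t, ENNReal.ofReal (Φ (u - x) i j) := by
      intro j
      have hf := hΦ i j
      have : Measurable fun p : ℝ × ℝ => ENNReal.ofReal (Φ (p.2 - p.1) i j) :=
        (hf.comp (measurable_snd.sub measurable_fst)).ennreal_ofReal
      exact this.lintegral_prod_right'
    have hω : ∀ ω, ∫⁻ u in Set.Ioc s t, intensity rate Φ Θ A (fun j => S j ω) i u
        = _ := fun ω =>
      setLIntegral_meanIntensity (rate := rate) (A := A) hΦ hΘ (fun j => counting (S j ω)) i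
        (Set.Ioc s t)
    rw [hνB _ _ measurableSet_Ioc, hci, setLIntegral_meanIntensity hΦ hΘ ν i]
    simp_rw [hω]
    generalize (∫⁻ _ in Set.Ioc s t, exogenous rate i) = C
    generalize (∫⁻ u in Set.Ioc s t, ∑ k, ∫⁻ s, ENNReal.ofReal (Θ (u - s) i k) ∂(A k)) = C'
    have hGκ : ∀ j, Measurable fun ω =>
        ∫⁻ x, (∫⁻ u in Set.Ioc s t, ENNReal.ofReal (Φ (u - x) i j)) ∂(counting (S j ω)) :=
      fun j => (Measure.measurable_lintegral (hG j)).comp (hκ j)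
    rw [lintegral_add_right _ measurable_const, lintegral_const, measure_univ, mul_one,
      lintegral_add_left measurable_const, lintegral_const, measure_univ, mul_one,
      lintegral_finsetSum _ fun j _ => hGκ j]
    congr 2
    refine Finset.sum_congr rfl fun j _ => ?_
    exact (Measure.lintegral_bind (hκ j).aemeasurable (hG j).aemeasurable).symm
  have hν : ∀ i, ν i = volume.withDensity (m i) := by
    intro i
    refine Measure.ext_of_Ioc _ _ fun s t hst => ?_
    rw [hIoc i s t hst.le, withDensity_apply _ measurableSet_Ioc]
  refine ⟨m, hm, fun i s t => ?_, fun i u => ?_⟩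
  · rw [← hνB _ _ measurableSet_Ioc, hν, withDensity_apply _ measurableSet_Ioc]
  · change meanIntensity rate Φ Θ A ν i u = _
    unfold meanIntensity
    congr 2
    refine Finset.sum_congr rfl fun j _ => ?_
    have hf := hΦ i j
    have hmeas : Measurable fun x => ENNReal.ofReal (Φ (u - x) i j) :=
      (hf.comp (measurable_id.const_sub u)).ennreal_ofReal
    rw [hν j]
    exact (lintegral_withDensity_eq_lintegral_mul _ (hm j) hmeas).trans
      (lintegral_congr fun x => mul_comm _ _)

end MeanMeasure

/-! ### Consequences of the stability condition -/

lemma laplace_zero (f : ℝ → ℝ) : laplace f 0 = ((∫ t, f t : ℝ) : ℂ) := by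
  simp only [laplace, mul_zero, zero_mul, neg_zero, Complex.exp_zero, one_mul]
  exact integral_complex_ofReal

/-- A root of the characteristic equation of the symmetric part is an eigenvalue of the block
matrix. -/
lemma mem_spectrum_of_symmetric_root {A B D : Matrix (Fin 2) (Fin 2) ℂ} {a b c e r : ℂ}
    (hA : ∀ i, A i 0 + A i 1 = a) (hB : ∀ i, B i 0 + B i 1 = b) (hD : ∀ i, D i 0 + D i 1 = e)
    (hr : (r - a) * (r - e) = c * b) :
    r ∈ spectrum ℂ (Matrix.fromBlocks A B (c • (1 : Matrix (Fin 2) (Fin 2) ℂ)) D) := by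
  set M := Matrix.fromBlocks A B (c • (1 : Matrix (Fin 2) (Fin 2) ℂ)) D
  rw [spectrum.mem_iff]
  intro hu
  have hinj := Matrix.mulVec_injective_iff_isUnit.2 hu
  -- Vectors constant on each block are preserved by `M`, which acts on them as the `2 × 2` matrix
  -- `(a b; c e)`.
  have hnull : ∀ p q : ℂ, a * p + b * q = r * p → c * p + e * q = r * q → p = 0 ∧ q = 0 := by
    intro p q h1 h2
    have hM : M.mulVec (Sum.elim (fun _ => p) fun _ => q)
        = r • (Sum.elim (fun _ => p) fun _ => q) := by
      ext i
      rcases i with i | i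
      · simp only [M, Matrix.mulVec, dotProduct, Fintype.sum_sum_type, Fin.sum_univ_two,
          Matrix.fromBlocks_apply₁₁, Matrix.fromBlocks_apply₁₂, Sum.elim_inl, Sum.elim_inr,
          Pi.smul_apply, smul_eq_mul]
        rw [← h1, ← hA i, ← hB i]; ring
      · simp only [M, Matrix.mulVec, dotProduct, Fintype.sum_sum_type, Fin.sum_univ_two,
          Matrix.fromBlocks_apply₂₁, Matrix.fromBlocks_apply₂₂, Sum.elim_inl, Sum.elim_inr,
          Pi.smul_apply, smul_eq_mul, Matrix.smul_apply]
        rw [← h2, ← hD i]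
        have h1 : (1 : Matrix (Fin 2) (Fin 2) ℂ) i 0 + (1 : Matrix (Fin 2) (Fin 2) ℂ) i 1 = 1 := by
          revert i
          simp [Fin.forall_fin_two]
        linear_combination c * p * h1
    have h0 : (Sum.elim (fun _ => p) (fun _ => q) : Comp → ℂ) = 0 := by
      apply hinj
      rw [Matrix.mulVec_zero, Matrix.sub_mulVec, hM, Algebra.algebraMap_eq_smul_one,
        Matrix.smul_mulVec, Matrix.one_mulVec, sub_self]
    exact ⟨congrFun h0 (Sum.inl 0), congrFun h0 (Sum.inr 0)⟩
  -- Both `(b, r - a)` and `(r - e, c)` solve the eigenvector equations. If both vanish, then `r =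
  -- a` and `c = 0`, and `(1, 0)` is an eigenvector.
  obtain ⟨hb, ha⟩ := hnull b (r - a) (by ring) (by linear_combination -hr)
  obtain ⟨he, hc⟩ := hnull (r - e) c (by linear_combination -hr) (by ring)
  have := hnull 1 0 (by linear_combination -ha) (by linear_combination hc)
  exact one_ne_zero this.1

/-- The larger root `r` of the characteristic polynomial is real because `c b ≥ 0`, and it dominates
`a` and `e`. Hence `r < 1` gives `c b = (r - a)(r - e) < (1 - a)(1 - e)`. -/
lemma stability_inequalities {a b c e : ℝ} (hcb : 0 ≤ c * b)
    (h : ∀ r : ℝ, (r - a) * (r - e) = c * b → r < 1) :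
    a < 1 ∧ e < 1 ∧ c * b < (1 - a) * (1 - e) := by
  set d := Real.sqrt (((a - e) / 2) ^ 2 + c * b)
  have hd : d ^ 2 = ((a - e) / 2) ^ 2 + c * b := Real.sq_sqrt (by positivity)
  have hd' : |(a - e) / 2| ≤ d := Real.abs_le_sqrt (by linarith)
  have hr := h ((a + e) / 2 + d) (by linear_combination hd)
  have h1 := abs_le.1 hd'
  refine ⟨by linarith, by linarith, ?_⟩
  have h2 : ((a + e) / 2 + d - a) * ((a + e) / 2 + d - e) = c * b := by linear_combination hd
  rw [← h2]
  exact mul_lt_mul'' (by linarith) (by linarith) (by linarith) (by linarith)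

/-- The total mass of the self and the cross term. -/
noncomputable def SymKernel.mass (K : SymKernel) : ℝ := (∫ t, K.self t) + ∫ t, K.cross t

/-- The imbalance of the kernel, self term minus cross term. -/
def SymKernel.diff (K : SymKernel) : ℝ → ℝ := fun t => K.self t - K.cross t

lemma SymKernel.hat_zero_row_sum (K : SymKernel) (i : Fin 2) :
    K.hat 0 i 0 + K.hat 0 i 1 = (K.mass : ℂ) := by
  fin_cases i <;> simp [SymKernel.hat, SymKernel.mass, laplace_zero, add_comm]

lemma SymKernel.IsKernel.mass_nonneg {K : SymKernel} (hK : K.IsKernel) : 0 ≤ K.mass :=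
  add_nonneg (integral_nonneg hK.1.nonneg) (integral_nonneg hK.2.nonneg)

/-- All that is needed from stability: the real eigenvalues on block-constant vectors. -/
lemma ImpulsiveStable.inequalities {KT KF KN : SymKernel} {c : ℝ} (hF : KF.IsKernel) (hc : 0 ≤ c)
    (h : ImpulsiveStable KT KF KN c) :
    KT.mass < 1 ∧ KN.mass < 1 ∧ c * KF.mass < (1 - KT.mass) * (1 - KN.mass) := by
  refine stability_inequalities (mul_nonneg hc hF.mass_nonneg) fun r hr => ?_
  have := h r (mem_spectrum_of_symmetric_root KT.hat_zero_row_sum KF.hat_zero_row_sum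
    KN.hat_zero_row_sum (by exact_mod_cast hr))
  rw [Complex.norm_real] at this
  exact (le_abs_self r).trans_lt this

namespace SymKernel.IsKernel

variable {K : SymKernel}

lemma integrable_diff (hK : K.IsKernel) : Integrable K.diff :=
  hK.1.integrable.sub hK.2.integrable

lemma measurable_diff (hK : K.IsKernel) : Measurable K.diff :=
  hK.1.measurable.sub hK.2.measurable

lemma diff_causal (hK : K.IsKernel) (t : ℝ) (ht : t < 0) : K.diff t = 0 := by
  simp [SymKernel.diff, hK.1.causal t ht, hK.2.causal t ht]

lemma integral_norm_diff_le (hK : K.IsKernel) : ∫ t, ‖K.diff t‖ ≤ K.mass := by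
  rw [SymKernel.mass, ← integral_add hK.1.integrable hK.2.integrable]
  refine integral_mono hK.integrable_diff.norm (hK.1.integrable.add hK.2.integrable) fun t => ?_
  have h1 := hK.1.nonneg t
  have h2 := hK.2.nonneg t
  simp only [SymKernel.diff, Real.norm_eq_abs]
  exact abs_le.2 ⟨by linarith, by linarith⟩

lemma lintegral_enorm_diff_le (hK : K.IsKernel) :
    ∫⁻ t, ‖K.diff t‖ₑ ≤ ENNReal.ofReal K.mass := by
  rw [← ofReal_integral_norm_eq_lintegral_enorm hK.integrable_diff]
  exact ENNReal.ofReal_le_ofReal hK.integral_norm_diff_le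

lemma laplace_diff (hK : K.IsKernel) {z : ℂ} (hz : z.im ≤ 0) : laplace K.diff z = K.imb z := by
  unfold SymKernel.imb laplace
  rw [← integral_sub (integrable_laplace_integrand hK.1.integrable hK.1.causal hz)
    (integrable_laplace_integrand hK.2.integrable hK.2.causal hz)]
  exact integral_congr_ae (.of_forall fun t => by simp [SymKernel.diff, mul_sub])

lemma norm_imb_le (hK : K.IsKernel) {z : ℂ} (hz : z.im ≤ 0) : ‖K.imb z‖ ≤ K.mass := by
  rw [← hK.laplace_diff hz]
  exact (norm_laplace_le hK.integrable_diff hK.diff_causal hz).trans hK.integral_norm_diff_le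

end SymKernel.IsKernel

/-- In the lower half-plane each imbalance transform is bounded by its mass, so the product has
modulus at least `(1 - a)(1 - e)`, more than the other term can reach. -/
lemma xiDenom_ne_zero {KT KF KN : SymKernel} {c : ℝ} (hT : KT.IsKernel) (hF : KF.IsKernel)
    (hN : KN.IsKernel) (hc : 0 ≤ c) (he : KN.mass < 1)
    (hD : c * KF.mass < (1 - KT.mass) * (1 - KN.mass)) {z : ℂ} (hz : z.im ≤ 0) :
    xiDenom KT KF KN c z ≠ 0 := by
  intro h
  rw [xiDenom, sub_eq_zero] at h
  have hsub : ∀ w : ℂ, 1 - ‖w‖ ≤ ‖1 - w‖ := fun w => by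
    simpa using norm_sub_norm_le (1 : ℂ) w
  have h1 : (1 - KT.mass) * (1 - KN.mass) ≤ ‖(1 - KT.imb z) * (1 - KN.imb z)‖ := by
    rw [norm_mul]
    refine mul_le_mul ?_ ?_ (by linarith) (norm_nonneg _)
    · linarith [hsub (KT.imb z), hT.norm_imb_le hz]
    · linarith [hsub (KN.imb z), hN.norm_imb_le hz]
  rw [h, norm_mul, Complex.norm_real, Real.norm_of_nonneg hc] at h1
  linarith [mul_le_mul_of_nonneg_left (hF.norm_imb_le hz) hc]

/-! ### The kernel of the decaying part of the impact -/

/-- The limit system for an impulsive impact: `c x` and `c θ` are the limits of the mean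
intensities of the imbalances of the trades and of the later price jumps. -/
lemma exists_causal_solution {KT KF KN : SymKernel} {c : ℝ} (hT : KT.IsKernel) (hF : KF.IsKernel)
    (hN : KN.IsKernel) (hc : 0 ≤ c) (ha : KT.mass < 1) (he : KN.mass < 1)
    (hD : c * KF.mass < (1 - KT.mass) * (1 - KN.mass)) :
    ∃ x θ : ℝ → ℝ, Measurable x ∧ Measurable θ ∧ Integrable x ∧ Integrable θ ∧
      (∀ t, t < 0 → x t = 0) ∧ (∀ t, t < 0 → θ t = 0) ∧
      x =ᵐ[volume] conv KT.diff x + conv KF.diff θ + KF.diff ∧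
      θ =ᵐ[volume] c • x + conv KN.diff θ + KN.diff := by
  obtain ⟨x₀, θ₀, ix₀, iθ₀, hx₀, hθ₀⟩ := exists_integrable_solution hc ha hD hT.integrable_diff
    hF.integrable_diff hN.integrable_diff hT.integral_norm_diff_le hF.integral_norm_diff_le
    hN.integral_norm_diff_le
  obtain ⟨x₁, mx₁, e₁⟩ := ix₀.1.aemeasurable
  obtain ⟨θ₁, mθ₁, e₂⟩ := iθ₀.1.aemeasurable
  have ix₁ := ix₀.congr e₁
  have iθ₁ := iθ₀.congr e₂
  rw [conv_congr e₁, conv_congr e₂] at hx₀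
  rw [conv_congr e₂] at hθ₀
  have hx₁ : ∀ᵐ u : ℝ, x₁ u = conv KT.diff x₁ u + conv KF.diff θ₁ u + KF.diff u := by
    filter_upwards [hx₀, e₁] with u h1 h2
    rw [← h2, h1]; rfl
  have hθ₁ : ∀ᵐ u : ℝ, θ₁ u = c * x₁ u + conv KN.diff θ₁ u + KN.diff u := by
    filter_upwards [hθ₀, e₁, e₂] with u h1 h2 h3
    rw [← h3, h1, ← h2]; rfl
  -- the kernels vanish in the past, and so does the solution
  have hwin : ∀ {f : ℝ → ℝ}, Integrable f → ∀ τ, windowSup (fun u => ‖f u‖ₑ) τ ≠ ∞ := fun hf τ =>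
    ((windowSup_le_lintegral _ τ).trans_lt hf.2).ne
  have hwin0 : ∀ {f : ℝ → ℝ}, (∀ t, t < 0 → f t = 0) → windowSup (fun u => ‖f u‖ₑ) 0 = 0 := by
    intro f hf
    rw [← nonpos_iff_eq_zero, windowSup_le_iff]
    intro t ht
    -- Causality says nothing about the value at `0`, so the right endpoint is discarded.
    rw [nonpos_iff_eq_zero, ← setLIntegral_congr Ioo_ae_eq_Ioc]
    refine setLIntegral_eq_zero measurableSet_Ioo fun u hu => ?_
    simp [hf u (hu.2.trans_le ht)]
  have hkc : ∀ {K : SymKernel}, K.IsKernel → ∀ t, t < 0 → ‖K.diff t‖ₑ = 0 := fun hK t ht => by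
    simp [hK.diff_causal t ht]
  have hX : windowSup (fun u => ‖x₁ u‖ₑ) 0 ≤ ENNReal.ofReal KT.mass * windowSup (fun u => ‖x₁ u‖ₑ) 0
      + ENNReal.ofReal KF.mass * windowSup (fun u => ‖θ₁ u‖ₑ) 0 + 0 := by
    rw [← hwin0 hF.diff_causal]
    refine windowSup_le_of_le_lconv_add_lconv_add hT.measurable_diff.enorm mx₁.enorm
      hF.measurable_diff.enorm mθ₁.enorm (hkc hT) (hkc hF) hT.lintegral_enorm_diff_le
      hF.lintegral_enorm_diff_le ?_ 0
    filter_upwards [hx₁] with u hu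
    rw [hu]
    refine (enorm_add_le _ _).trans (add_le_add_left ((enorm_add_le _ _).trans ?_) _)
    exact add_le_add (enorm_conv_le _ _ u) (enorm_conv_le _ _ u)
  have hΘ : windowSup (fun u => ‖θ₁ u‖ₑ) 0 ≤ ENNReal.ofReal KN.mass * windowSup (fun u => ‖θ₁ u‖ₑ) 0
      + ENNReal.ofReal c * windowSup (fun u => ‖x₁ u‖ₑ) 0 + 0 := by
    rw [← hwin0 hN.diff_causal, add_assoc]
    refine (windowSup_le_of_le_lconv_add (R := fun u => ‖θ₁ u‖ₑ)
      (g := fun u => ENNReal.ofReal c * ‖x₁ u‖ₑ + ‖KN.diff u‖ₑ) hN.measurable_diff.enorm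
      mθ₁.enorm (hkc hN) hN.lintegral_enorm_diff_le ?_ 0).trans ?_
    · filter_upwards [hθ₁] with u hu
      nth_rewrite 1 [hu]
      rw [← add_assoc, add_comm (c * x₁ u)]
      refine (enorm_add_le _ _).trans (add_le_add_left ((enorm_add_le _ _).trans ?_) _)
      rw [enorm_mul, Real.enorm_of_nonneg hc]
      exact add_le_add_left (enorm_conv_le _ _ u) _
    · gcongr
      refine (windowSup_add_le (by fun_prop) 0).trans ?_
      gcongr
      exact windowSup_const_mul_le ENNReal.ofReal_ne_top 0
  have hzero : ∀ {f : ℝ → ℝ}, Measurable f → Integrable f → ∀ d : ℝ, 0 < d →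
      d * (windowSup (fun u => ‖f u‖ₑ) 0).toReal ≤ 0 → f =ᵐ[volume] (Set.Ici 0).indicator f := by
    intro f hf hfi d hd h
    have h0 : (windowSup (fun u => ‖f u‖ₑ) 0).toReal = 0 :=
      le_antisymm (by nlinarith) ENNReal.toReal_nonneg
    rw [ENNReal.toReal_eq_zero_iff, or_iff_left (hwin hfi 0)] at h0
    filter_upwards [ae_eq_zero_of_windowSup_eq_zero hf.enorm.aemeasurable h0] with u hu
    by_cases hu0 : 0 ≤ u
    · rw [Set.indicator_of_mem (Set.mem_Ici.2 hu0)]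
    · rw [Set.indicator_of_notMem (by simpa using hu0)]
      simpa using hu (not_le.1 hu0).le
  -- `ennreal_system_bound` controls the second unknown only, so it is used twice, here with the
  -- roles exchanged and `KN.mass < 1` in place of `KT.mass < 1`.
  have hx₂ := hzero mx₁ ix₁ ((1 - KN.mass) * (1 - KT.mass) - KF.mass * c) (by linarith) (by
    simpa using ennreal_system_bound hc hF.mass_nonneg hN.mass_nonneg hT.mass_nonneg he
      (hwin iθ₁ 0) (hwin ix₁ 0) ENNReal.zero_ne_top ENNReal.zero_ne_top hΘ
      (by rwa [add_comm (ENNReal.ofReal KF.mass * _)]))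
  have hθ₂ := hzero mθ₁ iθ₁ ((1 - KT.mass) * (1 - KN.mass) - c * KF.mass) (by linarith) (by
    simpa using ennreal_system_bound hF.mass_nonneg hc hT.mass_nonneg hN.mass_nonneg ha
      (hwin ix₁ 0) (hwin iθ₁ 0) ENNReal.zero_ne_top ENNReal.zero_ne_top hX
      (by rwa [add_comm (ENNReal.ofReal c * _)]))
  refine ⟨(Set.Ici 0).indicator x₁, (Set.Ici 0).indicator θ₁, mx₁.indicator measurableSet_Ici,
    mθ₁.indicator measurableSet_Ici, ix₁.congr hx₂, iθ₁.congr hθ₂,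
    fun t ht => Set.indicator_of_notMem (by simpa using ht) _,
    fun t ht => Set.indicator_of_notMem (by simpa using ht) _, ?_, ?_⟩
  · rw [← conv_congr hx₂, ← conv_congr hθ₂]
    exact hx₂.symm.trans hx₁
  · rw [← conv_congr hθ₂]
    filter_upwards [hx₂, hθ₂, hθ₁] with u h1 h2 h3
    rw [← h2, h3, h1]; rfl

lemma laplace_solution {KT KF KN : SymKernel} {c : ℝ} (hT : KT.IsKernel) (hF : KF.IsKernel)
    (hN : KN.IsKernel) {x θ : ℝ → ℝ} (ix : Integrable x) (iθ : Integrable θ)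
    (cx : ∀ t, t < 0 → x t = 0) (cθ : ∀ t, t < 0 → θ t = 0)
    (hx : x =ᵐ[volume] conv KT.diff x + conv KF.diff θ + KF.diff)
    (hθ : θ =ᵐ[volume] c • x + conv KN.diff θ + KN.diff) {z : ℂ} (hz : z.im ≤ 0)
    (hD : xiDenom KT KF KN c z ≠ 0) : laplace (-θ) z = xiHat KT KF KN c z := by
  have iT := integrable_conv hT.integrable_diff ix
  have iF := integrable_conv hF.integrable_diff iθ
  have iN := integrable_conv hN.integrable_diff iθ
  have cT := conv_causal hT.diff_causal cx
  have cF := conv_causal hF.diff_causal cθ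
  have cN := conv_causal hN.diff_causal cθ
  have h1 : laplace x z = KT.imb z * laplace x z + KF.imb z * laplace θ z + KF.imb z := by
    conv_lhs => rw [laplace_congr hx]
    rw [laplace_add (iT.add iF) hF.integrable_diff
        (fun t ht => by simp [cT t ht, cF t ht]) hF.diff_causal hz,
      laplace_add iT iF cT cF hz, laplace_conv hT.integrable_diff ix hT.diff_causal cx hz,
      laplace_conv hF.integrable_diff iθ hF.diff_causal cθ hz, hT.laplace_diff hz,
      hF.laplace_diff hz]
  have h2 : laplace θ z = c * laplace x z + KN.imb z * laplace θ z + KN.imb z := by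
    conv_lhs => rw [laplace_congr hθ]
    rw [laplace_add ((ix.smul c).add iN) hN.integrable_diff
        (fun t ht => by simp [cx t ht, cN t ht]) hN.diff_causal hz,
      laplace_add (ix.smul c) iN (fun t ht => by simp [cx t ht]) cN hz, laplace_smul,
      laplace_conv hN.integrable_diff iθ hN.diff_causal cθ hz, hN.laplace_diff hz]
  have h3 : laplace (-θ) z = -laplace θ z := by
    have := laplace_smul (-1) θ z
    simpa using this
  rw [h3, xiHat, eq_sub_iff_add_eq, ← eq_sub_iff_add_eq', div_eq_iff hD]
  rw [xiDenom]
  -- These multipliers eliminate `laplace x z`.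
  linear_combination -(c : ℂ) * h1 - (1 - KT.imb z) * h2

/-! ### The mean imbalances of trades and price jumps -/

lemma integrable_conv_integrand_toReal {k : ℝ → ℝ} (hk : Measurable k) (hk0 : ∀ t, 0 ≤ k t)
    {m : ℝ → ℝ≥0∞} (hm : Measurable m) (hfin : ∀ᵐ s : ℝ, m s ≠ ∞) {u : ℝ}
    (h : lconv (fun t => ENNReal.ofReal (k t)) m u ≠ ∞) :
    Integrable (fun s => k (u - s) * (m s).toReal) ∧
      (lconv (fun t => ENNReal.ofReal (k t)) m u).toReal = conv k (fun s => (m s).toReal) u := by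
  have hmeas : Measurable fun s => k (u - s) * (m s).toReal := by fun_prop
  have hnn : ∀ s, 0 ≤ k (u - s) * (m s).toReal := fun s => mul_nonneg (hk0 _) ENNReal.toReal_nonneg
  have heq : ∫⁻ s, ENNReal.ofReal (k (u - s) * (m s).toReal)
      = lconv (fun t => ENNReal.ofReal (k t)) m u := by
    refine lintegral_congr_ae ?_
    filter_upwards [hfin] with s hs
    rw [ENNReal.ofReal_mul (hk0 _), ENNReal.ofReal_toReal hs]
  refine ⟨⟨hmeas.aestronglyMeasurable, ?_⟩, ?_⟩
  · rw [hasFiniteIntegral_iff_ofReal (.of_forall hnn), heq]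
    exact h.lt_top
  · rw [conv, integral_eq_lintegral_of_nonneg_ae (.of_forall hnn) hmeas.aestronglyMeasurable, heq]

lemma conv_sub_sub {k k' f f' : ℝ → ℝ} {u : ℝ}
    (h₁ : Integrable fun s => k (u - s) * f s) (h₂ : Integrable fun s => k' (u - s) * f' s)
    (h₃ : Integrable fun s => k (u - s) * f' s) (h₄ : Integrable fun s => k' (u - s) * f s) :
    (Integrable fun s => (k (u - s) - k' (u - s)) * (f s - f' s)) ∧
      conv (fun t => k t - k' t) (fun s => f s - f' s) u
        = conv k f u + conv k' f' u - conv k f' u - conv k' f u := by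
  have heq : (fun s => (k (u - s) - k' (u - s)) * (f s - f' s)) = fun s =>
      k (u - s) * f s + k' (u - s) * f' s - k (u - s) * f' s - k' (u - s) * f s := by
    ext s; ring
  have h₅ : Integrable fun s => k (u - s) * f s + k' (u - s) * f' s - k (u - s) * f' s :=
    (h₁.add h₂).sub h₃
  have h₆ : Integrable fun s => k (u - s) * f s + k' (u - s) * f' s := h₁.add h₂
  refine ⟨heq ▸ h₅.sub h₄, ?_⟩
  unfold conv
  rw [heq, integral_sub h₅ h₄, integral_sub h₆ h₃, integral_add h₁ h₂]

variable {Ω : Type*} {mΩ : MeasurableSpace Ω} {ℙ : Measure Ω} {ℱ : Filtration ℝ mΩ} {rate : ℝ≥0}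
  {KT KF KI KN : SymKernel} {S : Comp → Ω → Set ℝ}

instance (k : Fin 2) : SFinite (singleBuy k) := by
  fin_cases k
  · exact inferInstanceAs (SFinite (0 : Measure ℝ))
  · exact inferInstanceAs (SFinite (Measure.dirac (0 : ℝ)))

lemma toReal_intensity_sum {a b₁ b₂ b₃ b₄ d x : ℝ≥0∞} (h : x = a + (b₁ + b₂ + (b₃ + b₄)) + d)
    (hx : x ≠ ∞) : (b₁ ≠ ∞ ∧ b₂ ≠ ∞ ∧ b₃ ≠ ∞ ∧ b₄ ≠ ∞) ∧
      x.toReal = a.toReal + (b₁.toReal + b₂.toReal + (b₃.toReal + b₄.toReal)) + d.toReal := by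
  subst h
  simp only [ENNReal.add_ne_top] at hx
  obtain ⟨⟨ha, ⟨h1, h2⟩, h3, h4⟩, hd⟩ := hx
  refine ⟨⟨h1, h2, h3, h4⟩, ?_⟩
  lift a to ℝ≥0 using ha
  lift b₁ to ℝ≥0 using h1
  lift b₂ to ℝ≥0 using h2
  lift b₃ to ℝ≥0 using h3
  lift b₄ to ℝ≥0 using h4
  lift d to ℝ≥0 using hd
  norm_cast

/-- Subtracting the component equations cancels the exogenous rate, and bisymmetry leaves products
of imbalances. Since `x` and `y` need not be integrable on the line, convergence of the convolutions
is recorded separately; it holds wherever the mean intensities are finite. -/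
lemma IsLabeledHawkes.exists_imbalance_density [IsProbabilityMeasure ℙ]
    (h : IsLabeledHawkes ℙ ℱ rate (hawkesKernel KT KF KI KN) (agentKernel KI) singleBuy S)
    (hT : KT.IsKernel) (hF : KF.IsKernel) (hI : KI.IsKernel) (hN : KN.IsKernel) :
    ∃ x y : ℝ → ℝ, Measurable x ∧ Measurable y ∧
      (∀ τ, windowSup (fun u => ‖x u‖ₑ) τ ≠ ∞) ∧ (∀ τ, windowSup (fun u => ‖y u‖ₑ) τ ≠ ∞) ∧
      (∀ t, 0 ≤ t → IntegrableOn y (Set.Ioc 0 t) ∧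
        marketImpact ℙ S t = ∫ u in Set.Ioc 0 t, y u) ∧
      ∀ᵐ u : ℝ, ((Integrable fun s => KT.diff (u - s) * x s) ∧
        (Integrable fun s => KF.diff (u - s) * y s) ∧
        (Integrable fun s => KI.diff (u - s) * x s) ∧
        (Integrable fun s => KN.diff (u - s) * y s)) ∧
        x u = conv KT.diff x u + conv KF.diff y u ∧
        y u = conv KI.diff x u + conv KN.diff y u + KI.diff u := by
  have hmΦ : ∀ i j, Measurable fun t => hawkesKernel KT KF KI KN t i j := by
    rintro (i | i) (j | j) <;> fin_cases i <;> fin_cases j <;>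
      simp only [hawkesKernel, SymKernel.mat, Matrix.fromBlocks_apply₁₁, Matrix.fromBlocks_apply₁₂,
        Matrix.fromBlocks_apply₂₁, Matrix.fromBlocks_apply₂₂] <;>
      first
      | exact hT.1.measurable | exact hT.2.measurable | exact hF.1.measurable
      | exact hF.2.measurable | exact hI.1.measurable | exact hI.2.measurable
      | exact hN.1.measurable | exact hN.2.measurable
  have hmΘ : ∀ i j, Measurable fun t => agentKernel KI t i j := by
    rintro (i | i) j <;> fin_cases i <;> fin_cases j <;>
      simp only [agentKernel, SymKernel.mat, Matrix.fromRows_apply_inl, Matrix.fromRows_apply_inr] <;>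
      first
      | exact hI.1.measurable | exact hI.2.measurable | exact measurable_const
  obtain ⟨m, mm, hIoc, hm⟩ := h.exists_mean_density hmΦ hmΘ
  have hfinIoc : ∀ i s t, ∫⁻ u in Set.Ioc s t, m i u ≠ ∞ := fun i s t => by
    rw [← hIoc]; exact (h.mean_lt_top i s t).ne
  have hwin : ∀ i τ, windowSup (m i) τ ≠ ∞ := by
    intro i τ
    obtain ⟨C, hC⟩ := h.mean_past_bounded
    -- Windows ending before `0` are covered by the bound on the past; the others lie in `(-1, τ]`,
    -- where the mean is finite.
    have hb : windowSup (m i) τ ≤ max (C : ℝ≥0∞) (∫⁻ u in Set.Ioc (-1) τ, m i u) := by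
      refine windowSup_le_iff.2 fun t ht => ?_
      rcases le_total t 0 with h0 | h0
      · rw [← hIoc]
        exact (hC i t h0).trans (le_max_left _ _)
      · exact (lintegral_mono_set (Set.Ioc_subset_Ioc (by linarith) ht)).trans (le_max_right _ _)
    exact (hb.trans_lt (max_lt ENNReal.coe_lt_top (hfinIoc i _ _).lt_top)).ne
  have hfin : ∀ i, ∀ᵐ u : ℝ, m i u ≠ ∞ := by
    intro i
    have h1 : ∀ n : ℕ, ∀ᵐ u : ℝ, u ∈ Set.Ioc (-n : ℝ) n → m i u ≠ ∞ := fun n => by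
      rw [← ae_restrict_iff' measurableSet_Ioc]
      exact (ae_lt_top (mm i) (hfinIoc i _ _)).mono fun _ hu => hu.ne
    filter_upwards [ae_all_iff.2 h1] with u hu
    obtain ⟨n, hn⟩ := exists_nat_gt |u|
    exact hu n ⟨(abs_lt.1 hn).1, (abs_lt.1 hn).2.le⟩
  set f : Comp → ℝ → ℝ := fun i u => (m i u).toReal
  have hf : ∀ i, Measurable (f i) := fun i => (mm i).ennreal_toReal
  have hwinsub : ∀ i j τ, windowSup (fun u => ‖f i u - f j u‖ₑ) τ ≠ ∞ := by
    intro i j τ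
    refine ne_top_of_le_ne_top (ENNReal.add_ne_top.2 ⟨hwin i τ, hwin j τ⟩)
      (le_trans (windowSup_mono_ae τ (.of_forall fun u => ?_))
        (windowSup_add_le (mm i).aemeasurable τ))
    refine enorm_sub_le.trans (add_le_add ?_ ?_) <;>
      exact (Real.enorm_of_nonneg ENNReal.toReal_nonneg).trans_le ENNReal.ofReal_toReal_le
  refine ⟨fun u => f (Sum.inl 1) u - f (Sum.inl 0) u, fun u => f (Sum.inr 1) u - f (Sum.inr 0) u,
    (hf _).sub (hf _), (hf _).sub (hf _), hwinsub _ _, hwinsub _ _, fun t ht => ?_, ?_⟩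
  · have hint : ∀ i, IntegrableOn (f i) (Set.Ioc 0 t) := fun i =>
      integrable_toReal_of_lintegral_ne_top (mm i).aemeasurable (hfinIoc i 0 t)
    have hmeas : ∀ i, Measurable fun ω => counting (S i ω) (Set.Ioc 0 t) := fun i =>
      (h.adapted i 0 t ht).mono (ℱ.le t) le_rfl
    have hcount : ∀ i, Integrable (fun ω => (counting (S i ω) (Set.Ioc 0 t)).toReal) ℙ := fun i =>
      integrable_toReal_of_lintegral_ne_top (hmeas i).aemeasurable (h.mean_lt_top i 0 t).ne
    have hmean : ∀ i, ∫ ω, (counting (S i ω) (Set.Ioc 0 t)).toReal ∂ℙ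
        = ∫ u in Set.Ioc 0 t, f i u := by
      intro i
      rw [integral_toReal (hmeas i).aemeasurable
          (ae_lt_top (hmeas i) (h.mean_lt_top i 0 t).ne),
        integral_toReal (mm i).aemeasurable (ae_lt_top (mm i) (hfinIoc i 0 t)), hIoc]
    refine ⟨(hint _).sub (hint _), ?_⟩
    rw [marketImpact, integral_sub (hcount _) (hcount _), hmean, hmean,
      ← integral_sub (hint _) (hint _)]
  · filter_upwards [hfin (Sum.inl 0), hfin (Sum.inl 1), hfin (Sum.inr 0), hfin (Sum.inr 1)]
      with u h0 h1 h2 h3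
    have e0 : m (Sum.inl 0) u = rate
        + (lconv (fun t => ENNReal.ofReal (KT.self t)) (m (Sum.inl 0)) u
          + lconv (fun t => ENNReal.ofReal (KT.cross t)) (m (Sum.inl 1)) u
          + (lconv (fun t => ENNReal.ofReal (KF.self t)) (m (Sum.inr 0)) u
          + lconv (fun t => ENNReal.ofReal (KF.cross t)) (m (Sum.inr 1)) u)) + 0 := by
      rw [hm]
      simp [exogenous, agentKernel, hawkesKernel, SymKernel.mat, Fin.sum_univ_two]
    have e1 : m (Sum.inl 1) u = rate
        + (lconv (fun t => ENNReal.ofReal (KT.cross t)) (m (Sum.inl 0)) u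
          + lconv (fun t => ENNReal.ofReal (KT.self t)) (m (Sum.inl 1)) u
          + (lconv (fun t => ENNReal.ofReal (KF.cross t)) (m (Sum.inr 0)) u
          + lconv (fun t => ENNReal.ofReal (KF.self t)) (m (Sum.inr 1)) u)) + 0 := by
      rw [hm]
      simp [exogenous, agentKernel, hawkesKernel, SymKernel.mat, Fin.sum_univ_two]
    have e2 : m (Sum.inr 0) u = 0
        + (lconv (fun t => ENNReal.ofReal (KI.self t)) (m (Sum.inl 0)) u
          + lconv (fun t => ENNReal.ofReal (KI.cross t)) (m (Sum.inl 1)) u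
          + (lconv (fun t => ENNReal.ofReal (KN.self t)) (m (Sum.inr 0)) u
          + lconv (fun t => ENNReal.ofReal (KN.cross t)) (m (Sum.inr 1)) u))
        + ENNReal.ofReal (KI.cross u) := by
      rw [hm]
      simp [exogenous, agentKernel, hawkesKernel, SymKernel.mat, Fin.sum_univ_two, singleBuy]
    have e3 : m (Sum.inr 1) u = 0
        + (lconv (fun t => ENNReal.ofReal (KI.cross t)) (m (Sum.inl 0)) u
          + lconv (fun t => ENNReal.ofReal (KI.self t)) (m (Sum.inl 1)) u
          + (lconv (fun t => ENNReal.ofReal (KN.cross t)) (m (Sum.inr 0)) u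
          + lconv (fun t => ENNReal.ofReal (KN.self t)) (m (Sum.inr 1)) u))
        + ENNReal.ofReal (KI.self u) := by
      rw [hm]
      simp [exogenous, agentKernel, hawkesKernel, SymKernel.mat, Fin.sum_univ_two, singleBuy]
    obtain ⟨⟨a01, a02, a03, a04⟩, r0⟩ := toReal_intensity_sum e0 h0
    obtain ⟨⟨a11, a12, a13, a14⟩, r1⟩ := toReal_intensity_sum e1 h1
    obtain ⟨⟨a21, a22, a23, a24⟩, r2⟩ := toReal_intensity_sum e2 h2
    obtain ⟨⟨a31, a32, a33, a34⟩, r3⟩ := toReal_intensity_sum e3 h3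
    have key : ∀ {K : SymKernel} {i j : Comp}, K.IsKernel →
        lconv (fun t => ENNReal.ofReal (K.self t)) (m i) u ≠ ∞ →
        lconv (fun t => ENNReal.ofReal (K.cross t)) (m j) u ≠ ∞ →
        lconv (fun t => ENNReal.ofReal (K.cross t)) (m i) u ≠ ∞ →
        lconv (fun t => ENNReal.ofReal (K.self t)) (m j) u ≠ ∞ →
        (Integrable fun s => K.diff (u - s) * (f j s - f i s)) ∧
        conv K.diff (fun s => f j s - f i s) u
          = (lconv (fun t => ENNReal.ofReal (K.self t)) (m j) u).toReal
            + (lconv (fun t => ENNReal.ofReal (K.cross t)) (m i) u).toReal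
            - (lconv (fun t => ENNReal.ofReal (K.self t)) (m i) u).toReal
            - (lconv (fun t => ENNReal.ofReal (K.cross t)) (m j) u).toReal := by
      intro K i j hK g1 g2 g3 g4
      obtain ⟨i1, q1⟩ := integrable_conv_integrand_toReal hK.1.measurable hK.1.nonneg (mm i) (hfin i) g1
      obtain ⟨i2, q2⟩ := integrable_conv_integrand_toReal hK.2.measurable hK.2.nonneg (mm j) (hfin j) g2
      obtain ⟨i3, q3⟩ := integrable_conv_integrand_toReal hK.2.measurable hK.2.nonneg (mm i) (hfin i) g3
      obtain ⟨i4, q4⟩ := integrable_conv_integrand_toReal hK.1.measurable hK.1.nonneg (mm j) (hfin j) g4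
      rw [q1, q2, q3, q4]
      exact conv_sub_sub i4 i3 i1 i2
    obtain ⟨j1, k1⟩ := key hT a01 a02 a11 a12
    obtain ⟨j2, k2⟩ := key hF a03 a04 a13 a14
    obtain ⟨j3, k3⟩ := key hI a21 a22 a31 a32
    obtain ⟨j4, k4⟩ := key hN a23 a24 a33 a34
    refine ⟨⟨j1, j2, j3, j4⟩, ?_, ?_⟩
    · rw [k1, k2]
      simp only [f]
      rw [r0, r1]
      ring
    · rw [k3, k4]
      simp only [f]
      rw [r2, r3, ENNReal.toReal_ofReal (hI.1.nonneg u), ENNReal.toReal_ofReal (hI.2.nonneg u),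
        SymKernel.diff]
      ring

/-! ### Convergence of the market impact profiles -/

lemma conv_sub_const_mul {k f g : ℝ → ℝ} {c u : ℝ} (hf : Integrable fun s => k (u - s) * f s)
    (hg : Integrable fun s => k (u - s) * g s) :
    conv k (fun s => f s - c * g s) u = conv k f u - c * conv k g u := by
  unfold conv
  rw [← integral_const_mul, ← integral_sub hf (hg.const_mul c)]
  exact integral_congr_ae (.of_forall fun s => by ring)

/-- The errors `x - c x'` and `y - φ - c θ` solve the same kind of system, with sources that measure
how far `φ` is from `c δ`. Eliminating the first error bounds the second by these sources. -/
lemma windowSup_error_bound {KT KF KN : SymKernel} {c : ℝ} (hT : KT.IsKernel) (hF : KF.IsKernel)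
    (hN : KN.IsKernel) (hc : 0 ≤ c) (ha : KT.mass < 1) {φ : ℝ → ℝ} (hφ : IsKernel φ)
    (hφc : ∫ t, φ t = c) {x y x' θ : ℝ → ℝ} (mx : Measurable x) (my : Measurable y)
    (mx' : Measurable x') (mθ : Measurable θ) (ix' : Integrable x') (iθ : Integrable θ)
    (hx' : x' =ᵐ[volume] conv KT.diff x' + conv KF.diff θ + KF.diff)
    (hθ : θ =ᵐ[volume] c • x' + conv KN.diff θ + KN.diff)
    (wx : ∀ τ, windowSup (fun u => ‖x u‖ₑ) τ ≠ ∞) (wy : ∀ τ, windowSup (fun u => ‖y u‖ₑ) τ ≠ ∞)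
    (hxy : ∀ᵐ u : ℝ, ((Integrable fun s => KT.diff (u - s) * x s) ∧
        (Integrable fun s => KF.diff (u - s) * y s) ∧
        (Integrable fun s => φ (u - s) * x s) ∧
        (Integrable fun s => KN.diff (u - s) * y s)) ∧
        x u = conv KT.diff x u + conv KF.diff y u ∧
        y u = conv φ x u + conv KN.diff y u + φ u) (τ : ℝ) :
    windowSup (fun u => ‖y u - φ u - c * θ u‖ₑ) τ ≠ ∞ ∧
    ((1 - KT.mass) * (1 - KN.mass) - c * KF.mass)
        * (windowSup (fun u => ‖y u - φ u - c * θ u‖ₑ) τ).toReal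
      ≤ c * (∫⁻ u, ‖conv KF.diff φ u - c * KF.diff u‖ₑ).toReal
        + (1 - KT.mass) * (ENNReal.ofReal c * (∫⁻ u, ‖conv x' φ u - c * x' u‖ₑ)
          + ∫⁻ u, ‖conv KN.diff φ u - c * KN.diff u‖ₑ).toReal := by
  have iφ := hφ.integrable
  have hwin : ∀ {g : ℝ → ℝ}, Integrable g → windowSup (fun u => ‖g u‖ₑ) τ ≠ ∞ := fun hg =>
    ((windowSup_le_lintegral _ τ).trans_lt hg.2).ne
  have hkc : ∀ {K : SymKernel}, K.IsKernel → ∀ t, t < 0 → ‖K.diff t‖ₑ = 0 := fun hK t ht => by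
    simp [hK.diff_causal t ht]
  have ierr : ∀ {g : ℝ → ℝ}, Integrable g → Integrable fun u => conv g φ u - c * g u := fun hg =>
    (integrable_conv hg iφ).sub (hg.const_mul c)
  have hφ1 : ∫⁻ s, ‖φ s‖ₑ ≤ ENNReal.ofReal c := by
    rw [← hφc, ofReal_integral_eq_lintegral_ofReal iφ (.of_forall hφ.nonneg)]
    exact lintegral_mono fun s => (Real.enorm_of_nonneg (hφ.nonneg s)).le
  have mφ := hφ.measurable
  have wP : windowSup (fun u => ‖x u - c * x' u‖ₑ) τ ≠ ∞ := by
    refine ne_top_of_le_ne_top (ENNReal.add_ne_top.2 ⟨wx τ, hwin (ix'.const_mul c)⟩) ?_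
    exact (windowSup_mono_ae τ (.of_forall fun u => enorm_sub_le)).trans
      (windowSup_add_le mx.enorm.aemeasurable τ)
  have wQ : windowSup (fun u => ‖y u - φ u - c * θ u‖ₑ) τ ≠ ∞ := by
    refine ne_top_of_le_ne_top (ENNReal.add_ne_top.2 ⟨wy τ, hwin (iφ.add (iθ.const_mul c))⟩) ?_
    refine (windowSup_mono_ae τ (.of_forall fun u => ?_)).trans
      (windowSup_add_le my.enorm.aemeasurable τ)
    rw [sub_sub]
    exact enorm_sub_le
  refine ⟨wQ, ?_⟩
  have hP := windowSup_le_of_le_lconv_add_lconv_add (k := fun s => ‖KT.diff s‖ₑ)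
    (k' := fun s => ‖KF.diff s‖ₑ) (R := fun u => ‖x u - c * x' u‖ₑ)
    (f := fun u => ‖x u - c * x' u‖ₑ) (f' := fun u => ‖y u - φ u - c * θ u‖ₑ)
    (g := fun u => ‖conv KF.diff φ u - c * KF.diff u‖ₑ)
    hT.measurable_diff.enorm (by fun_prop) hF.measurable_diff.enorm (by fun_prop) (hkc hT) (hkc hF)
    hT.lintegral_enorm_diff_le hF.lintegral_enorm_diff_le (by
      filter_upwards [hxy, hx', ae_integrable_conv_integrand hT.integrable_diff ix',
        ae_integrable_conv_integrand hF.integrable_diff iθ,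
        ae_integrable_conv_integrand hF.integrable_diff iφ]
        with u ⟨⟨i1, i2, _, _⟩, h1, _⟩ h2 i3 i4 i5
      have i6 : Integrable fun s => KF.diff (u - s) * (y s - φ s) := by
        simp only [mul_sub]
        exact i2.sub i5
      have h3 : conv KF.diff (fun s => y s - φ s) u = conv KF.diff y u - conv KF.diff φ u := by
        simpa using conv_sub_const_mul (c := 1) i2 i5
      -- Here `y` contains `φ`, so `KF.diff * φ` appears where the limit system has `c KF.diff`.
      have h4 : x u - c * x' u = conv KT.diff (fun s => x s - c * x' s) u
          + conv KF.diff (fun s => y s - φ s - c * θ s) u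
          + (conv KF.diff φ u - c * KF.diff u) := by
        rw [conv_sub_const_mul i1 i3, conv_sub_const_mul i6 i4, h3, h1, h2]
        simp only [Pi.add_apply]
        ring
      rw [h4]
      refine (enorm_add_le _ _).trans (add_le_add_left ((enorm_add_le _ _).trans ?_) _)
      exact add_le_add (enorm_conv_le _ _ u) (enorm_conv_le _ _ u)) τ
  have hQ := windowSup_le_of_le_lconv_add_lconv_add (k := fun s => ‖φ s‖ₑ)
    (k' := fun s => ‖KN.diff s‖ₑ) (R := fun u => ‖y u - φ u - c * θ u‖ₑ)
    (f := fun u => ‖x u - c * x' u‖ₑ) (f' := fun u => ‖y u - φ u - c * θ u‖ₑ)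
    (g := fun u => ENNReal.ofReal c * ‖conv x' φ u - c * x' u‖ₑ
      + ‖conv KN.diff φ u - c * KN.diff u‖ₑ)
    mφ.enorm (by fun_prop) hN.measurable_diff.enorm (by fun_prop)
    (fun t ht => by simp [hφ.causal t ht]) (hkc hN) hφ1 hN.lintegral_enorm_diff_le (by
      filter_upwards [hxy, hθ, ae_integrable_conv_integrand iφ ix',
        ae_integrable_conv_integrand hN.integrable_diff iθ,
        ae_integrable_conv_integrand hN.integrable_diff iφ]
        with u ⟨⟨_, _, i1, i2⟩, _, h1⟩ h2 i3 i4 i5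
      have i6 : Integrable fun s => KN.diff (u - s) * (y s - φ s) := by
        simp only [mul_sub]
        exact i2.sub i5
      have h3 : conv KN.diff (fun s => y s - φ s) u = conv KN.diff y u - conv KN.diff φ u := by
        simpa using conv_sub_const_mul (c := 1) i2 i5
      have h4 : y u - φ u - c * θ u = conv φ (fun s => x s - c * x' s) u
          + conv KN.diff (fun s => y s - φ s - c * θ s) u
          -- The impact term splits as `φ * x = φ * (x - c x') + c φ * x'`, and the limit of its
          -- last part is `c² x'`.
          + (c * (conv x' φ u - c * x' u) + (conv KN.diff φ u - c * KN.diff u)) := by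
        rw [conv_sub_const_mul i1 i3, conv_sub_const_mul i6 i4, h3, h1, h2, conv_comm x' φ]
        simp only [Pi.add_apply, Pi.smul_apply, smul_eq_mul]
        ring
      rw [h4]
      refine (enorm_add_le _ _).trans (add_le_add ((enorm_add_le _ _).trans ?_) ?_)
      · exact add_le_add (enorm_conv_le _ _ u) (enorm_conv_le _ _ u)
      · refine (enorm_add_le _ _).trans (add_le_add_left ?_ _)
        rw [enorm_mul, Real.enorm_of_nonneg hc]) τ
  refine ennreal_system_bound hF.mass_nonneg hc hT.mass_nonneg hN.mass_nonneg ha wP wQ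
    (ierr hF.integrable_diff).2.ne
    (ENNReal.add_ne_top.2 ⟨ENNReal.mul_ne_top ENNReal.ofReal_ne_top (ierr ix').2.ne,
      (ierr hN.integrable_diff).2.ne⟩)
    (hP.trans (add_le_add_right (windowSup_le_lintegral _ τ) _))
    (hQ.trans (add_le_add_right ?_ _))
  refine (windowSup_le_lintegral _ τ).trans (le_of_eq ?_)
  rw [lintegral_add_right' _ (ierr hN.integrable_diff).1.enorm,
    lintegral_const_mul' _ _ ENNReal.ofReal_ne_top]

lemma setIntegral_eq_integral_of_support_subset {φ : ℝ → ℝ} {w t : ℝ} (hwt : w < t)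
    (hsupp : Function.support φ ⊆ Set.Icc 0 w) : ∫ u in Set.Ioc 0 t, φ u = ∫ u, φ u := by
  rw [← integral_Icc_eq_integral_Ioc]
  exact setIntegral_eq_integral_of_forall_compl_eq_zero fun u hu => by
    by_contra h
    exact hu (Set.Icc_subset_Icc le_rfl hwt.le (hsupp h))

lemma norm_setIntegral_le_windowSup {q : ℝ → ℝ} {t : ℝ}
    (hq : windowSup (fun u => ‖q u‖ₑ) t ≠ ∞) :
    ‖∫ u in Set.Ioc 0 t, q u‖ ≤ ⌈t⌉₊ * (windowSup (fun u => ‖q u‖ₑ) t).toReal := by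
  have h1 : ‖∫ u in Set.Ioc 0 t, q u‖ₑ ≤ ⌈t⌉₊ * windowSup (fun u => ‖q u‖ₑ) t := by
    refine (enorm_integral_le_lintegral_enorm _).trans
      (le_trans (lintegral_mono_set (Set.Ioc_subset_Ioc ?_ le_rfl))
        (setLIntegral_le_mul_windowSup _ t ⌈t⌉₊))
    linarith [Nat.le_ceil t]
  have h2 := ENNReal.toReal_mono (ENNReal.mul_ne_top (ENNReal.natCast_ne_top _) hq) h1
  rwa [toReal_enorm, ENNReal.toReal_mul, ENNReal.toReal_natCast] at h2

end MarketImpact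

theorem corollary1 (KT KF KN : MarketImpact.SymKernel)
    (hT : KT.IsKernel) (hF : KF.IsKernel) (hN : KN.IsKernel)
    (c : ℝ) (hc : 0 ≤ c) (rate : ℝ≥0)
    (hstable : MarketImpact.ImpulsiveStable KT KF KN c) :
    ∃ ξ : ℝ → ℝ,
      Integrable ξ ∧ (∀ t, t < 0 → ξ t = 0) ∧
      (∀ z : ℂ, z.im ≤ 0 →
        MarketImpact.xiDenom KT KF KN c z ≠ 0 ∧
        MarketImpact.laplace ξ z = MarketImpact.xiHat KT KF KN c z) ∧
      (∀ ξ' : ℝ → ℝ, Integrable ξ' →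
        (∀ z : ℝ, MarketImpact.laplace ξ' (z : ℂ) = MarketImpact.xiHat KT KF KN c (z : ℂ)) →
        ξ' =ᵐ[volume] ξ) ∧
      ∀ (KI : ℕ → MarketImpact.SymKernel), MarketImpact.IsImpulsive KI c →
      ∀ (Ω : ℕ → Type*) (mΩ : ∀ n, MeasurableSpace (Ω n))
        (ℙ : ∀ n, Measure (Ω n)) (_ : ∀ n, IsProbabilityMeasure (ℙ n))
        (ℱ : ∀ n, Filtration ℝ (mΩ n))
        (S : ∀ n, MarketImpact.Comp → Ω n → Set ℝ),
        (∀ n, MarketImpact.IsLabeledHawkes (ℙ n) (ℱ n) rate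
          (MarketImpact.hawkesKernel KT KF (KI n) KN)
          (MarketImpact.agentKernel (KI n)) MarketImpact.singleBuy (S n)) →
        ∀ t : ℝ, 0 < t →
          Tendsto (fun n => MarketImpact.marketImpact (ℙ n) (S n) t) atTop
            (𝓝 (c * (1 - ∫ u in (0 : ℝ)..t, ξ u))) := by
  open MarketImpact in
  obtain ⟨ha, he, hD⟩ := hstable.inequalities hF hc
  obtain ⟨x', θ, mx', mθ, ix', iθ, cx', cθ, hx', hθ⟩ := exists_causal_solution hT hF hN hc ha he hD
  have hden : ∀ z : ℂ, z.im ≤ 0 → xiDenom KT KF KN c z ≠ 0 := fun z hz =>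
    xiDenom_ne_zero hT hF hN hc he hD hz
  have hlap : ∀ z : ℂ, z.im ≤ 0 → laplace (-θ) z = xiHat KT KF KN c z := fun z hz =>
    laplace_solution hT hF hN ix' iθ cx' cθ hx' hθ hz (hden z hz)
  -- The later price jumps have limiting mean imbalance `c θ`, so the decay kernel is `-θ`.
  refine ⟨-θ, iθ.neg, fun t ht => by simp [cθ t ht], fun z hz => ⟨hden z hz, hlap z hz⟩, ?_, ?_⟩
  · intro ξ' iξ' hξ'
    exact ae_eq_of_laplace_eq iξ' iθ.neg fun z => (hξ' z).trans (hlap z (by simp)).symm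
  · intro KI hKI Ω mΩ ℙ hℙ ℱ S hS t ht
    obtain ⟨hK, hcross, hmass, w, hw, hsupp⟩ := hKI
    have hdiff : ∀ n, (KI n).diff = (KI n).self := fun n => by
      ext u; simp [SymKernel.diff, hcross n]
    choose x y mx my wx wy hy hxy using fun n =>
      (hS n).exists_imbalance_density hT hF (hK n) hN
    simp only [hdiff] at hxy
    have hbound := fun n => windowSup_error_bound hT hF hN hc ha (hK n).1 (hmass n) (mx n) (my n)
      mx' mθ ix' iθ hx' hθ (wx n) (wy n) (hxy n) t
    have happrox : ∀ {g : ℝ → ℝ}, Integrable g →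
        Tendsto (fun n => ∫⁻ u, ‖conv g (KI n).self u - c * g u‖ₑ) atTop (𝓝 0) := fun hg =>
      tendsto_lintegral_conv_sub hg (fun n => (hK n).1) hmass hw hsupp
    set d := (1 - KT.mass) * (1 - KN.mass) - c * KF.mass
    have hd : 0 < d := sub_pos.2 hD
    set E : ℕ → ℝ := fun n => c * (∫⁻ u, ‖conv KF.diff (KI n).self u - c * KF.diff u‖ₑ).toReal
        + (1 - KT.mass) * (ENNReal.ofReal c * (∫⁻ u, ‖conv x' (KI n).self u - c * x' u‖ₑ)
          + ∫⁻ u, ‖conv KN.diff (KI n).self u - c * KN.diff u‖ₑ).toReal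
    have hE : Tendsto E atTop (𝓝 0) := by
      have h1 := (ENNReal.tendsto_toReal ENNReal.zero_ne_top).comp (happrox hF.integrable_diff)
      have h2 := (ENNReal.Tendsto.const_mul (a := ENNReal.ofReal c) (happrox ix')
        (Or.inr ENNReal.ofReal_ne_top)).add (happrox hN.integrable_diff)
      rw [mul_zero, add_zero] at h2
      have h3 := (ENNReal.tendsto_toReal ENNReal.zero_ne_top).comp h2
      simpa using (h1.const_mul c).add (h3.const_mul (1 - KT.mass))
    rw [tendsto_iff_norm_sub_tendsto_zero]
    refine squeeze_zero' (g := fun n => ⌈t⌉₊ * (E n / d)) (.of_forall fun n => norm_nonneg _) ?_ ?_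
    -- Once `w n < t`, the whole mass `c` of the impact kernel lies in the window `(0, t]`; this is
    -- the immediate impact.
    · filter_upwards [hw.eventually_lt_const ht] with n hn
      obtain ⟨wQ, hQ⟩ := hbound n
      have heq : marketImpact (ℙ n) (S n) t - c * (1 - ∫ u in (0 : ℝ)..t, (-θ) u)
          = ∫ u in Set.Ioc 0 t, (y n u - (KI n).self u - c * θ u) := by
        obtain ⟨iy, hMI⟩ := hy n t ht.le
        have iφ : IntegrableOn (KI n).self (Set.Ioc 0 t) := (hK n).1.integrable.integrableOn
        have iθ' : IntegrableOn (fun u => c * θ u) (Set.Ioc 0 t) := (iθ.const_mul c).integrableOn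
        have iyφ : IntegrableOn (fun u => y n u - (KI n).self u) (Set.Ioc 0 t) := iy.sub iφ
        rw [hMI, integral_sub iyφ iθ', integral_sub iy iφ,
          setIntegral_eq_integral_of_support_subset hn (hsupp n), hmass n, integral_const_mul,
          intervalIntegral.integral_of_le ht.le]
        simp only [Pi.neg_apply, integral_neg]
        ring
      rw [heq]
      refine (norm_setIntegral_le_windowSup wQ).trans ?_
      gcongr
      rw [le_div_iff₀ hd, mul_comm]
      exact hQ
    · simpa using (hE.div_const d).const_mul (⌈t⌉₊ : ℝ)
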